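/- **Model.** Consider one major agent (index $0$) and $n$ minor agents $i\in N=\{1,\dots,n\}$ over the horizon $t=1,\dots,T$, $T\ge 1$. The stacked state $x(t)=\mathrm{vec}(x_0(t),\dots,x_n(t))$ and control $u(t)=\mathrm{vec}(u_0(t),\dots,u_n(t))$ satisfy $x(t+1)=Ax(t)+Bu(t)+w(t)$, where the only nonzero blocks of $A$ and $B$ are $A_{ii},A_{i0}$ and $B_{ii},B_{i0}$; minor agent $i$ has the output $y_i(t)=C_{ii}x_i(t)+v_i(t)$. The primitive random vectors $x_i(1)$, $w_i(t)$ ($0\le i\le n$) and $v_i(t)$ ($i\in N$), $1\le t\le T$, are independent and have zero mean and finite variance (they need not be Gaussian). The agents' information is $I_0(t)=\{x_0(1{:}t),u_0(1{:}t-1)\}$, which is also the common information $I^c(t)$, and $I_i(t)=\{x_0(1{:}t),y_i(1{:}t),u_0(1{:}t-1),u_i(1{:}t-1)\}$ for $i\in N$. An affine strategy $g$ is a family of affine control laws $u_i(t)=g_{i,t}(I_i(t))$, $0\le i\le n$, and its cost is $$J(g)=\mathbb E\Big[\sum_{t=1}^{T-1}\big(x(t)^{\top}Qx(t)+u(t)^{\top}Ru(t)\big)+x(T)^{\top}Q_Tx(T)\Big],$$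 where $Q,Q_T$ are symmetric positive semidefinite and $R$ is symmetric positive definite. **Splitting.** For a given strategy put $u^c(t)=\mathbb E[u(t)\mid I^c(t)]$ and $u^\ell(t)=u(t)-u^c(t)$. Let $x^c(1)=x^\ell(1)=0$, $x^s(1)=x(1)$, and $x^c(t+1)=Ax^c(t)+Bu^c(t)$, $x^\ell(t+1)=Ax^\ell(t)+Bu^\ell(t)$, $x^s(t+1)=Ax^s(t)+w(t)$. Let $z^c(t)=x^c(t)+x^s(t)$ and $z^\ell_i(t)=x^\ell_i(t)+x^s_i(t)$. Let $H_0(t)$ and $H_i(t)$ be the linear spans in $L^2$ of the components of $I_0(t)$ and $I_i(t)$. Write $\mathbb L[\,\cdot\mid H]$ for the componentwise orthogonal projection in $L^2$ onto $H$ (the linear least mean square estimate), and define $$\hat z^c(t)=\mathbb L[z^c(t)\mid H_0(t)],\qquad \hat z^\ell_i(t)=\mathbb L[z^\ell_i(t)\mid H_i(t)]-\mathbb L[z^\ell_i(t)\mid H_0(t)].$$ Thus $\hat z^\ell_i(t)$ is the projection of $z^\ell_i(t)$ onto the orthogonal complement of $H_0(t)$ in $H_i(t)$. **Gains.** Let $\mathcal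 R(P,A,B,Q,R)=Q+A^{\top}PA-A^{\top}PB(R+B^{\top}PB)^{-1}B^{\top}PA$ and $\mathcal G(P,A,B,R)=(R+B^{\top}PB)^{-1}B^{\top}PA$. Let $S^c(T)=Q_T$ and $S^\ell_i(T)=[Q_T]_{ii}$, and for $t=T-1,\dots,1$ let $S^c(t)=\mathcal R(S^c(t+1),A,B,Q,R)$, $S^\ell_i(t)=\mathcal R(S^\ell_i(t+1),A_{ii},B_{ii},Q_{ii},R_{ii})$, $L^c(t)=\mathcal G(S^c(t+1),A,B,R)$ and $L^\ell_i(t)=\mathcal G(S^\ell_i(t+1),A_{ii},B_{ii},R_{ii})$. **Theorem.** Every affine strategy has a finite cost, and there is an affine strategy that minimizes $J$ among all affine strategies. An affine strategy is a minimizer if and only if, under it, for all $t=1,\dots,T-1$, almost surely $$u^c(t)=-L^c(t)\,\hat z^c(t)\qquad\text{and}\qquad u^\ell_i(t)=-L^\ell_i(t)\,\hat z^\ell_i(t)\quad\text{for all } i\in N.$$ The minimizer is unique in the sense that any two minimizing affine strategies generate almost surely the same control actions $u(1),\dots,u(T-1)$. -/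

import Mathlib

open MeasureTheory ProbabilityTheory Matrix
open scoped ENNReal

noncomputable section

namespace MajorMinor

/-! Time is counted from `0`: the instants `1, …, T` of a problem with horizon `T ≥ 1` are written
`0, …, N` with `N = T - 1`.  Control actions are taken, and running costs incurred, at the
instants `t < N`; the terminal cost is incurred at `N`.
Agent `0 : Fin (n + 1)` is the major agent and `i.succ`, for `i : Fin n`, are the minor agents.
The stacked vector of a family of vectors `v i ∈ ℝ^(d i)` is indexed by `Σ i, Fin (d i)`. -/

/-- Index set of a stacked (block) vector with block sizes `d`. -/
abbrev Stacked {n : ℕ} (d : Fin (n + 1) → ℕ) : Type := Σ i : Fin (n + 1), Fin (d i)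

/-- The deterministic data of a linear quadratic system with one major and `n` minor agents. -/
structure Model (n : ℕ) where
  /-- number of decision instants (horizon minus one) -/
  N : ℕ
  /-- dimensions of the states -/
  dx : Fin (n + 1) → ℕ
  /-- dimensions of the controls -/
  du : Fin (n + 1) → ℕ
  /-- dimensions of the outputs of the minor agents -/
  dy : Fin n → ℕ
  A : Matrix (Stacked dx) (Stacked dx) ℝ
  B : Matrix (Stacked dx) (Stacked du) ℝ
  C : ∀ i : Fin n, Matrix (Fin (dy i)) (Fin (dx i.succ)) ℝ
  Q : Matrix (Stacked dx) (Stacked dx) ℝ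
  QT : Matrix (Stacked dx) (Stacked dx) ℝ
  R : Matrix (Stacked du) (Stacked du) ℝ
  /-- the only nonzero blocks of `A` are `A i i` and `A i 0` -/
  A_sparse : ∀ i j : Fin (n + 1), i ≠ j → j ≠ 0 → ∀ a b, A ⟨i, a⟩ ⟨j, b⟩ = 0
  /-- the only nonzero blocks of `B` are `B i i` and `B i 0` -/
  B_sparse : ∀ i j : Fin (n + 1), i ≠ j → j ≠ 0 → ∀ a b, B ⟨i, a⟩ ⟨j, b⟩ = 0
  Q_posSemidef : Q.PosSemidef
  QT_posSemidef : QT.PosSemidef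
  R_posDef : R.PosDef

variable {n : ℕ} {Ω : Type*}

/-- The `i`-th diagonal block of a block matrix. -/
def diagBlock {d e : Fin (n + 1) → ℕ} (M : Matrix (Stacked d) (Stacked e) ℝ) (i : Fin (n + 1)) :
    Matrix (Fin (d i)) (Fin (e i)) ℝ :=
  Matrix.of fun a b => M ⟨i, a⟩ ⟨i, b⟩

/-! ### Riccati recursions and gains -/

section Riccati

variable {X U : Type*} [Fintype X] [Fintype U] [DecidableEq U]

/-- `Q + Aᵀ P A - Aᵀ P B (R + Bᵀ P B)⁻¹ Bᵀ P A`. -/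
def riccati (P A : Matrix X X ℝ) (B : Matrix X U ℝ) (Q : Matrix X X ℝ) (R : Matrix U U ℝ) :
    Matrix X X ℝ :=
  Q + Aᵀ * P * A - Aᵀ * P * B * (R + Bᵀ * P * B)⁻¹ * Bᵀ * P * A

/-- `(R + Bᵀ P B)⁻¹ Bᵀ P A`. -/
def gain (P A : Matrix X X ℝ) (B : Matrix X U ℝ) (R : Matrix U U ℝ) : Matrix U X ℝ :=
  (R + Bᵀ * P * B)⁻¹ * Bᵀ * P * A

/-- Solution of the backward Riccati recursion with terminal value `QT`, as a function of the
number of steps to go. -/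
def riccatiSol (A : Matrix X X ℝ) (B : Matrix X U ℝ) (Q QT : Matrix X X ℝ) (R : Matrix U U ℝ) :
    ℕ → Matrix X X ℝ
  | 0 => QT
  | k + 1 => riccati (riccatiSol A B Q QT R k) A B Q R

end Riccati

namespace Model

variable (M : Model n)

/-- `S^c(t)` for `t ≤ N`; thus `S^c(N) = QT`. -/
def Sc (t : ℕ) : Matrix (Stacked M.dx) (Stacked M.dx) ℝ :=
  riccatiSol M.A M.B M.Q M.QT M.R (M.N - t)

/-- `S^ℓ_i(t)` for `t ≤ N`; thus `S^ℓ_i(N)` is the `i`-th diagonal block of `QT`. -/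
def Sl (i : Fin n) (t : ℕ) : Matrix (Fin (M.dx i.succ)) (Fin (M.dx i.succ)) ℝ :=
  riccatiSol (diagBlock M.A i.succ) (diagBlock M.B i.succ) (diagBlock M.Q i.succ)
    (diagBlock M.QT i.succ) (diagBlock M.R i.succ) (M.N - t)

/-- The gain `L^c(t)`, `t < N`. -/
def Lc (t : ℕ) : Matrix (Stacked M.du) (Stacked M.dx) ℝ :=
  gain (M.Sc (t + 1)) M.A M.B M.R

/-- The gain `L^ℓ_i(t)`, `t < N`. -/
def Ll (i : Fin n) (t : ℕ) : Matrix (Fin (M.du i.succ)) (Fin (M.dx i.succ)) ℝ :=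
  gain (M.Sl i (t + 1)) (diagBlock M.A i.succ) (diagBlock M.B i.succ) (diagBlock M.R i.succ)

end Model

/-! ### Primitive random variables -/

/-- The primitive random variables: initial states, process noises, observation noises. -/
structure Noise (M : Model n) (Ω : Type*) where
  init : ∀ i : Fin (n + 1), Ω → Fin (M.dx i) → ℝ
  w : ∀ i : Fin (n + 1), ℕ → Ω → Fin (M.dx i) → ℝ
  v : ∀ i : Fin n, ℕ → Ω → Fin (M.dy i) → ℝ

/-- Labels of the primitive random variables at the instants `0, …, N`. -/
inductive Primitive (n N : ℕ) : Type
  | init (i : Fin (n + 1))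
  | w (i : Fin (n + 1)) (t : Fin (N + 1))
  | v (i : Fin n) (t : Fin (N + 1))

/-- Dimension of a primitive random vector. -/
def Model.primDim (M : Model n) : Primitive n M.N → ℕ
  | .init i => M.dx i
  | .w i _ => M.dx i
  | .v i _ => M.dy i

/-- The family of all primitive random vectors. -/
def Noise.prim {M : Model n} (P : Noise M Ω) :
    (p : Primitive n M.N) → Ω → Fin (M.primDim p) → ℝ
  | .init i => P.init i
  | .w i t => P.w i t
  | .v i t => P.v i t

/-- The primitive random vectors are independent, have zero mean and finite variance. -/
structure Noise.Admissible {M : Model n} [MeasurableSpace Ω] (P : Noise M Ω) (μ : Measure Ω) :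
    Prop where
  measurable : ∀ p, Measurable (P.prim p)
  memLp_two : ∀ p a, MemLp (fun ω => P.prim p ω a) 2 μ
  mean_zero : ∀ p a, ∫ ω, P.prim p ω a ∂μ = 0
  indep : iIndepFun P.prim μ

/-- The stacked initial state. -/
def Noise.x₁ {M : Model n} (P : Noise M Ω) (ω : Ω) : Stacked M.dx → ℝ :=
  fun p => P.init p.1 ω p.2

/-- The stacked process noise `w(t)`. -/
def Noise.W {M : Model n} (P : Noise M Ω) (t : ℕ) (ω : Ω) : Stacked M.dx → ℝ :=
  fun p => P.w p.1 t ω p.2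

/-! ### Dynamics, information and affine strategies -/

/-- A control process: `u t ω` is the stacked vector of the control actions at time `t`. -/
abbrev Control (M : Model n) (Ω : Type*) : Type _ := ℕ → Ω → Stacked M.du → ℝ

/-- Scalar coordinates of `I_0(t) = (x_0(0:t), u_0(0:t-1))`. -/
abbrev Model.MajorIdx (M : Model n) (t : ℕ) : Type :=
  (Fin (t + 1) × Fin (M.dx 0)) ⊕ (Fin t × Fin (M.du 0))

/-- Scalar coordinates of `I_i(t) = (x_0(0:t), u_0(0:t-1), y_i(0:t), u_i(0:t-1))`. -/
abbrev Model.MinorIdx (M : Model n) (i : Fin n) (t : ℕ) : Type :=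
  M.MajorIdx t ⊕ ((Fin (t + 1) × Fin (M.dy i)) ⊕ (Fin t × Fin (M.du i.succ)))

section Dynamics

variable {M : Model n} (P : Noise M Ω) (u : Control M Ω)

/-- The state: `x(t+1) = A x(t) + B u(t) + w(t)`. -/
def state : ℕ → Ω → Stacked M.dx → ℝ
  | 0, ω => P.x₁ ω
  | t + 1, ω => M.A *ᵥ state t ω + M.B *ᵥ u t ω + P.W t ω

/-- The output `y_i(t) = C_ii x_i(t) + v_i(t)` of a minor agent. -/
def output (i : Fin n) (t : ℕ) (ω : Ω) : Fin (M.dy i) → ℝ :=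
  M.C i *ᵥ (fun a => state P u t ω ⟨i.succ, a⟩) + P.v i t ω

/-- `I_0(t)`, which is also the common information `I^c(t)`. -/
def majorInfo (t : ℕ) (ω : Ω) : M.MajorIdx t → ℝ :=
  Sum.elim (fun p => state P u p.1 ω ⟨0, p.2⟩) (fun p => u p.1 ω ⟨0, p.2⟩)

/-- `I_i(t)` for a minor agent. -/
def minorInfo (i : Fin n) (t : ℕ) (ω : Ω) : M.MinorIdx i t → ℝ :=
  Sum.elim (majorInfo P u t ω)
    (Sum.elim (fun p => output P u i p.1 ω p.2) (fun p => u p.1 ω ⟨i.succ, p.2⟩))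

end Dynamics

/-- An affine strategy: control laws `g_{i,t}` that are affine functions of `I_i(t)`.
Only those at the instants `t < N` influence the cost. -/
structure AffineStrategy (M : Model n) where
  major : ∀ t, (M.MajorIdx t → ℝ) →ᵃ[ℝ] (Fin (M.du 0) → ℝ)
  minor : ∀ (i : Fin n) (t), (M.MinorIdx i t → ℝ) →ᵃ[ℝ] (Fin (M.du i.succ) → ℝ)

namespace AffineStrategy

variable {M : Model n} (g : AffineStrategy M) (P : Noise M Ω)

/-- The actions prescribed by `g` at time `t` when the controls used so far are `u`. -/
def act (u : Control M Ω) (t : ℕ) (ω : Ω) : Stacked M.du → ℝ := fun p =>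
  Fin.cases (motive := fun j => Fin (M.du j) → ℝ) (g.major t (majorInfo P u t ω))
    (fun i => g.minor i t (minorInfo P u i t ω)) p.1 p.2

/-- Controls generated by `g` at the instants `< t` (and `0` from time `t` on). -/
def controlUpTo : ℕ → Control M Ω
  | 0 => 0
  | t + 1 => Function.update (controlUpTo t) t (g.act P (controlUpTo t) t)

/-- The closed-loop control process generated by `g`. -/
def control : Control M Ω := fun t => g.controlUpTo P (t + 1) t

end AffineStrategy

theorem state_congr {M : Model n} (P : Noise M Ω) {u u' : Control M Ω} {t : ℕ}
    (h : ∀ s < t, u s = u' s) : state P u t = state P u' t := by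
  induction t with
  | zero => rfl
  | succ t ih =>
    funext ω
    simp only [state]
    rw [ih fun s hs => h s (by omega), h t (by omega)]

/-- The closed loop satisfies `u_i(t) = g_{i,t}(I_i(t))`, with the information generated by the
closed loop itself. -/
theorem AffineStrategy.control_eq {M : Model n} (g : AffineStrategy M) (P : Noise M Ω) (t : ℕ) :
    g.control P t = g.act P (g.control P) t := by
  have hist : ∀ t s, s < t → g.controlUpTo P t s = g.control P s := by
    intro t
    induction t with
    | zero => intro s hs; omega
    | succ t ih =>
      intro s hs
      rcases Nat.lt_succ_iff_lt_or_eq.mp hs with h | rfl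
      · rw [controlUpTo, Function.update_of_ne h.ne, ih s h]
      · rfl
  have h1 : g.control P t = g.act P (g.controlUpTo P t) t := by
    simp [control, controlUpTo]
  have hst : ∀ s : Fin (t + 1), state P (g.controlUpTo P t) s = state P (g.control P) s :=
    fun s => state_congr P fun r hr => hist t r (by omega)
  have hu : ∀ s : Fin t, g.controlUpTo P t s = g.control P s := fun s => hist t s s.2
  rw [h1]
  funext ω p
  simp only [act, minorInfo, majorInfo, output, hst, hu]

section Cost

variable {M : Model n}

/-- The total cost incurred along the sample path `ω`. -/
def pathCost (P : Noise M Ω) (u : Control M Ω) (ω : Ω) : ℝ :=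
  ∑ t ∈ Finset.range M.N,
      (state P u t ω ⬝ᵥ M.Q *ᵥ state P u t ω + u t ω ⬝ᵥ M.R *ᵥ u t ω) +
    state P u M.N ω ⬝ᵥ M.QT *ᵥ state P u M.N ω

variable [MeasurableSpace Ω]

/-- The performance `J(g)`. -/
def AffineStrategy.cost (g : AffineStrategy M) (P : Noise M Ω) (μ : Measure Ω) : ℝ :=
  ∫ ω, pathCost P (g.control P) ω ∂μ

/-- `g` minimizes the expected cost among all affine strategies. -/
def AffineStrategy.IsOptimal (g : AffineStrategy M) (P : Noise M Ω) (μ : Measure Ω) : Prop :=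
  ∀ g' : AffineStrategy M, g.cost P μ ≤ g'.cost P μ

end Cost

/-! ### Splitting of controls and states -/

section Split

variable {M : Model n} [MeasurableSpace Ω] (P : Noise M Ω) (μ : Measure Ω) (u : Control M Ω)

/-- `u^c(t) = E[u(t) | I^c(t)]`, coordinate by coordinate. -/
def commonControl : Control M Ω := fun t ω p =>
  (μ[fun ω' => u t ω' p | MeasurableSpace.comap (majorInfo P u t) inferInstance]) ω

/-- `u^ℓ(t) = u(t) - u^c(t)`. -/
def localControl : Control M Ω := fun t ω => u t ω - commonControl P μ u t ω

/-- `x^c`. -/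
def commonState : ℕ → Ω → Stacked M.dx → ℝ
  | 0, _ => 0
  | t + 1, ω => M.A *ᵥ commonState t ω + M.B *ᵥ commonControl P μ u t ω

/-- `x^ℓ`. -/
def localState : ℕ → Ω → Stacked M.dx → ℝ
  | 0, _ => 0
  | t + 1, ω => M.A *ᵥ localState t ω + M.B *ᵥ localControl P μ u t ω

/-- `x^s`. -/
def stochState : ℕ → Ω → Stacked M.dx → ℝ
  | 0, ω => P.x₁ ω
  | t + 1, ω => M.A *ᵥ stochState t ω + P.W t ω

/-- `z^c(t) = x^c(t) + x^s(t)`. -/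
def zc (t : ℕ) (ω : Ω) : Stacked M.dx → ℝ :=
  commonState P μ u t ω + stochState P t ω

/-- `z^ℓ_i(t) = x^ℓ_i(t) + x^s_i(t)`. -/
def zl (i : Fin n) (t : ℕ) (ω : Ω) : Fin (M.dx i.succ) → ℝ := fun a =>
  localState P μ u t ω ⟨i.succ, a⟩ + stochState P t ω ⟨i.succ, a⟩

end Split

/-! ### Linear least mean square estimates -/

section LLMS

variable [MeasurableSpace Ω] (μ : Measure Ω)

open Classical in
/-- The class in `L²(μ)` of a real random variable.  Every random variable to which this is applied
below is square integrable when the control process comes from an affine strategy; the default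
value `0` only makes the function total. -/
def toL2 (f : Ω → ℝ) : Lp ℝ 2 μ := if h : MemLp f 2 μ then h.toLp f else 0

/-- The span in `L²(μ)` of finitely many real random variables. -/
def spanL2 {ι : Type*} (f : Ω → ι → ℝ) : Submodule ℝ (Lp ℝ 2 μ) :=
  Submodule.span ℝ (Set.range fun k => toL2 μ fun ω => f ω k)

instance {ι : Type*} [Finite ι] (f : Ω → ι → ℝ) : FiniteDimensional ℝ (spanL2 μ f) :=
  FiniteDimensional.span_of_finite ℝ (Set.finite_range _)

/-- The LLMS estimate of `f` given `H`: the orthogonal projection of `f` onto `H`. -/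
def llms (H : Submodule ℝ (Lp ℝ 2 μ)) [H.HasOrthogonalProjection] (f : Ω → ℝ) : Lp ℝ 2 μ :=
  H.starProjection (toL2 μ f)

variable {M : Model n} (P : Noise M Ω) (u : Control M Ω)

/-- `H_0(t) = span I_0(t)`. -/
abbrev H0 (t : ℕ) : Submodule ℝ (Lp ℝ 2 μ) := spanL2 μ (majorInfo P u t)

/-- `H_i(t) = span I_i(t)`. -/
abbrev Hi (i : Fin n) (t : ℕ) : Submodule ℝ (Lp ℝ 2 μ) := spanL2 μ (minorInfo P u i t)

/-- The orthogonal complement of `H_0(t)` within `H_i(t)`. -/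
abbrev Htilde (i : Fin n) (t : ℕ) : Submodule ℝ (Lp ℝ 2 μ) := (H0 μ P u t)ᗮ ⊓ Hi μ P u i t

/-- `ẑ^c(t) = 𝕃[z^c(t) | H_0(t)]`, coordinate by coordinate. -/
def zcHat (t : ℕ) (ω : Ω) : Stacked M.dx → ℝ := fun p =>
  llms μ (H0 μ P u t) (fun ω' => zc P μ u t ω' p) ω

/-- `ẑ^ℓ_i(t) = 𝕃[z^ℓ_i(t) | H_i(t)] - 𝕃[z^ℓ_i(t) | H_0(t)]`, coordinate by coordinate. -/
def zlHat (i : Fin n) (t : ℕ) (ω : Ω) : Fin (M.dx i.succ) → ℝ := fun a =>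
  llms μ (Hi μ P u i t) (fun ω' => zl P μ u i t ω' a) ω -
    llms μ (H0 μ P u t) (fun ω' => zl P μ u i t ω' a) ω

theorem H0_le_Hi (i : Fin n) (t : ℕ) : H0 μ P u t ≤ Hi μ P u i t := by
  refine Submodule.span_mono ?_
  rintro _ ⟨k, rfl⟩
  exact ⟨Sum.inl k, rfl⟩

/-- `ẑ^ℓ_i(t)` is the projection of `z^ℓ_i(t)` onto the orthogonal complement of `H_0(t)` within
`H_i(t)`. -/
theorem zlHat_ae_eq (i : Fin n) (t : ℕ) (a : Fin (M.dx i.succ)) :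
    (fun ω => zlHat μ P u i t ω a) =ᵐ[μ]
      llms μ (Htilde μ P u i t) (fun ω' => zl P μ u i t ω' a) := by
  have key : llms μ (Htilde μ P u i t) (fun ω' => zl P μ u i t ω' a) =
      llms μ (Hi μ P u i t) (fun ω' => zl P μ u i t ω' a) -
        llms μ (H0 μ P u t) (fun ω' => zl P μ u i t ω' a) := by
    unfold llms
    generalize toL2 μ (fun ω' => zl P μ u i t ω' a) = f
    have hle := H0_le_Hi μ P u i t
    refine (Submodule.eq_starProjection_of_mem_orthogonal (K := Htilde μ P u i t) ?_ ?_)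
    · refine Submodule.mem_inf.mpr ⟨?_, ?_⟩
      · have h1 := Submodule.sub_starProjection_mem_orthogonal (K := Hi μ P u i t) f
        have h2 := Submodule.sub_starProjection_mem_orthogonal (K := H0 μ P u t) f
        have h3 := Submodule.sub_mem _ h2 (Submodule.orthogonal_le hle h1)
        convert h3 using 1
        abel
      · exact Submodule.sub_mem _ (Submodule.starProjection_apply_mem _ _)
          (hle (Submodule.starProjection_apply_mem _ _))
    · have h1 := Submodule.sub_starProjection_mem_orthogonal (K := Hi μ P u i t) f
      have h1' := Submodule.orthogonal_le (inf_le_right : Htilde μ P u i t ≤ _) h1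
      have h2 : (H0 μ P u t).starProjection f ∈ (Htilde μ P u i t)ᗮ :=
        Submodule.orthogonal_le inf_le_left
          (Submodule.le_orthogonal_orthogonal _ (Submodule.starProjection_apply_mem _ _))
      have h3 := Submodule.add_mem _ h1' h2
      convert h3 using 1
      abel
  rw [key]
  filter_upwards [Lp.coeFn_sub (llms μ (Hi μ P u i t) (fun ω' => zl P μ u i t ω' a))
    (llms μ (H0 μ P u t) (fun ω' => zl P μ u i t ω' a))] with ω hω
  rw [hω]
  rfl

end LLMS

/-- At every decision instant, almost surely,
`u^c(t) = -L^c(t) ẑ^c(t)` and `u^ℓ_i(t) = -L^ℓ_i(t) ẑ^ℓ_i(t)` for every minor agent `i`. -/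
def AffineStrategy.HasGainForm {M : Model n} [MeasurableSpace Ω] (g : AffineStrategy M)
    (P : Noise M Ω) (μ : Measure Ω) : Prop :=
  ∀ t < M.N,
    (∀ᵐ ω ∂μ, commonControl P μ (g.control P) t ω =
      -(M.Lc t *ᵥ zcHat μ P (g.control P) t ω)) ∧
    ∀ i : Fin n, ∀ᵐ ω ∂μ, (fun a => localControl P μ (g.control P) t ω ⟨i.succ, a⟩) =
      -(M.Ll i t *ᵥ zlHat μ P (g.control P) i t ω)

end MajorMinor

end

/-!
Past controls are affine functions of past information, so they can be subtracted out of the data: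
up to the constants, an agent knows the same subspace of `L²` whatever affine strategy is in use.
In `L²` the control problem is therefore a deterministic quadratic minimization.  Projecting onto
the knowledge of the major agent splits it into one common regulator and `n` local ones; the local
parts of distinct minor agents are orthogonal, because their primitive random vectors are
independent, so the costs add up.  In each regulator the noise is orthogonal to the information,
and completing the squares leaves a constant plus a positive definite form in the deviation from
the certainty equivalent feedback.  A strategy is optimal exactly if all these deviations vanish.

The certainty equivalent feedback projects onto spaces that contain the constants, while the
estimates of the theorem use linear spans.  Under this feedback the state and the information have
zero mean, so both projections agree; an induction over time makes this available in both
directions of the characterization.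
-/

noncomputable section

namespace MajorMinor

/-! ### Vectors over an inner product space -/

theorem isSymm_of_posSemidef {X : Type*} {S : Matrix X X ℝ} (hS : S.PosSemidef) :
    S.IsSymm :=
  Matrix.isHermitian_iff_isSymm.1 hS.isHermitian

/-- The product of a real matrix with a column vector whose entries lie in a real vector space. -/
def smulVec {V X Y : Type*} [AddCommGroup V] [Module ℝ V] [Fintype Y] (A : Matrix X Y ℝ)
    (x : Y → V) : X → V := fun i => ∑ j, A i j • x j

local notation:73 A:74 " •ᵥ " x:73 => smulVec A x

section MatrixAction

variable {V V' X Y Z : Type*} [AddCommGroup V] [Module ℝ V] [AddCommGroup V'] [Module ℝ V']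
  [Fintype Y] [Fintype Z]

theorem smulVec_add (A : Matrix X Y ℝ) (x y : Y → V) : A •ᵥ (x + y) = A •ᵥ x + A •ᵥ y := by
  funext i; simp [smulVec, smul_add, Finset.sum_add_distrib]

theorem smulVec_sub (A : Matrix X Y ℝ) (x y : Y → V) : A •ᵥ (x - y) = A •ᵥ x - A •ᵥ y := by
  funext i; simp [smulVec, smul_sub, Finset.sum_sub_distrib]

@[simp]
theorem smulVec_zero (A : Matrix X Y ℝ) : A •ᵥ (0 : Y → V) = 0 := by
  funext i; simp [smulVec]

theorem add_smulVec (A B : Matrix X Y ℝ) (x : Y → V) : (A + B) •ᵥ x = A •ᵥ x + B •ᵥ x := by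
  funext i; simp [smulVec, add_smul, Finset.sum_add_distrib]

theorem sub_smulVec (A B : Matrix X Y ℝ) (x : Y → V) : (A - B) •ᵥ x = A •ᵥ x - B •ᵥ x := by
  funext i; simp [smulVec, sub_smul, Finset.sum_sub_distrib]

theorem neg_smulVec (A : Matrix X Y ℝ) (x : Y → V) : (-A) •ᵥ x = -(A •ᵥ x) := by
  funext i; simp [smulVec]

theorem one_smulVec [DecidableEq Y] (x : Y → V) : (1 : Matrix Y Y ℝ) •ᵥ x = x := by
  funext i; simp [smulVec, Matrix.one_apply, ite_smul]

theorem smulVec_smulVec (A : Matrix X Y ℝ) (B : Matrix Y Z ℝ) (x : Z → V) :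
    A •ᵥ B •ᵥ x = (A * B) •ᵥ x := by
  funext i
  simp only [smulVec, Matrix.mul_apply, Finset.sum_smul, Finset.smul_sum, smul_smul]
  exact Finset.sum_comm

theorem smulVec_eq_mulVec (A : Matrix X Y ℝ) (x : Y → ℝ) : A •ᵥ x = A *ᵥ x := by
  funext i; simp [smulVec, Matrix.mulVec, dotProduct]

theorem map_smulVec (f : V →ₗ[ℝ] V') (A : Matrix X Y ℝ) (x : Y → V) (i : X) :
    f ((A •ᵥ x) i) = (A •ᵥ fun j => f (x j)) i := by
  simp [smulVec]

theorem smulVec_mem {K : Submodule ℝ V} (A : Matrix X Y ℝ) {x : Y → V} (hx : ∀ j, x j ∈ K)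
    (i : X) : (A •ᵥ x) i ∈ K :=
  K.sum_mem fun j _ => K.smul_mem _ (hx j)

end MatrixAction

section QuadraticForm

variable {E X Y : Type*} [NormedAddCommGroup E] [InnerProductSpace ℝ E] [Fintype X] [Fintype Y]

/-- The inner product of two vectors with entries in an inner product space: the sum of the inner
products of their entries. -/
def innerSum (x y : X → E) : ℝ := ∑ i, inner ℝ (x i) (y i)

theorem innerSum_add_left (x y z : X → E) : innerSum (x + y) z = innerSum x z + innerSum y z := by
  simp [innerSum, inner_add_left, Finset.sum_add_distrib]

theorem innerSum_add_right (x y z : X → E) :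
    innerSum x (y + z) = innerSum x y + innerSum x z := by
  simp [innerSum, inner_add_right, Finset.sum_add_distrib]

theorem innerSum_sub_right (x y z : X → E) :
    innerSum x (y - z) = innerSum x y - innerSum x z := by
  simp [innerSum, inner_sub_right, Finset.sum_sub_distrib]

theorem innerSum_comm (x y : X → E) : innerSum x y = innerSum y x :=
  Finset.sum_congr rfl fun _ _ => real_inner_comm _ _

theorem innerSum_self_nonneg (x : X → E) : 0 ≤ innerSum x x :=
  Finset.sum_nonneg fun _ _ => real_inner_self_nonneg

theorem innerSum_self_eq_zero {x : X → E} (h : innerSum x x = 0) : x = 0 := by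
  have := (Finset.sum_eq_zero_iff_of_nonneg fun i _ => real_inner_self_nonneg).1 h
  funext i
  exact inner_self_eq_zero.1 (this i (Finset.mem_univ i))

theorem innerSum_eq_zero_of_mem_orthogonal {K : Submodule ℝ E} {x y : X → E} (hx : ∀ i, x i ∈ K)
    (hy : ∀ i, y i ∈ Kᗮ) : innerSum x y = 0 :=
  Finset.sum_eq_zero fun i _ => Submodule.inner_right_of_mem_orthogonal (hx i) (hy i)

theorem innerSum_smulVec_left (A : Matrix X Y ℝ) (x : Y → E) (y : X → E) :
    innerSum (A •ᵥ x) y = innerSum x (Aᵀ •ᵥ y) := by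
  simp only [innerSum, smulVec, sum_inner, inner_sum, inner_smul_left, inner_smul_right,
    Matrix.transpose_apply]
  exact Finset.sum_comm

theorem innerSum_smulVec_symm {S : Matrix X X ℝ} (hS : S.IsSymm) (x y : X → E) :
    innerSum x (S •ᵥ y) = innerSum y (S •ᵥ x) := by
  rw [innerSum_comm, innerSum_smulVec_left, hS.eq]

/-- The quadratic form of a matrix `S`, evaluated at a vector with entries in an inner product
space. -/
def quadForm (S : Matrix X X ℝ) (x : X → E) : ℝ := innerSum x (S •ᵥ x)

@[simp]
theorem quadForm_zero (S : Matrix X X ℝ) : quadForm S (0 : X → E) = 0 := by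
  simp [quadForm, innerSum]

theorem quadForm_add_matrix (S T : Matrix X X ℝ) (x : X → E) :
    quadForm (S + T) x = quadForm S x + quadForm T x := by
  rw [quadForm, add_smulVec, innerSum_add_right, quadForm, quadForm]

theorem quadForm_sub_matrix (S T : Matrix X X ℝ) (x : X → E) :
    quadForm (S - T) x = quadForm S x - quadForm T x := by
  rw [quadForm, sub_smulVec, innerSum_sub_right, quadForm, quadForm]

theorem quadForm_add {S : Matrix X X ℝ} (hS : S.IsSymm) (x y : X → E) :
    quadForm S (x + y) = quadForm S x + 2 * innerSum x (S •ᵥ y) + quadForm S y := by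
  simp only [quadForm, smulVec_add, innerSum_add_left, innerSum_add_right]
  rw [innerSum_smulVec_symm hS y x]
  ring

theorem quadForm_smulVec (S : Matrix X X ℝ) (A : Matrix X Y ℝ) (x : Y → E) :
    quadForm S (A •ᵥ x) = quadForm (Aᵀ * S * A) x := by
  rw [quadForm, quadForm, innerSum_smulVec_left, smulVec_smulVec, smulVec_smulVec,
    Matrix.mul_assoc]

theorem quadForm_add_of_mem_orthogonal {S : Matrix X X ℝ} (hS : S.IsSymm) {K : Submodule ℝ E}
    {x y : X → E} (hx : ∀ i, x i ∈ K) (hy : ∀ i, y i ∈ Kᗮ) :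
    quadForm S (x + y) = quadForm S x + quadForm S y := by
  rw [quadForm_add hS, innerSum_eq_zero_of_mem_orthogonal hx (smulVec_mem S hy)]
  ring

theorem quadForm_eq_dotProduct_mulVec (S : Matrix X X ℝ) (x : X → ℝ) :
    quadForm S x = x ⬝ᵥ S *ᵥ x := by
  simp [quadForm, innerSum, smulVec_eq_mulVec, dotProduct, mul_comm]

open scoped MatrixOrder in
theorem exists_eq_transpose_mul_self {S : Matrix X X ℝ} (hS : S.PosSemidef) :
    ∃ D : Matrix X X ℝ, S = Dᵀ * D := by
  classical
  obtain ⟨D, hD⟩ := CStarAlgebra.nonneg_iff_eq_star_mul_self.mp hS.nonneg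
  exact ⟨D, by rw [hD, Matrix.star_eq_conjTranspose, Matrix.conjTranspose_eq_transpose_of_trivial]⟩

theorem quadForm_transpose_mul_self (D : Matrix X X ℝ) (x : X → E) :
    quadForm (Dᵀ * D) x = innerSum (D •ᵥ x) (D •ᵥ x) := by
  rw [quadForm, ← smulVec_smulVec, ← innerSum_smulVec_left]

theorem quadForm_nonneg {S : Matrix X X ℝ} (hS : S.PosSemidef) (x : X → E) :
    0 ≤ quadForm S x := by
  obtain ⟨D, rfl⟩ := exists_eq_transpose_mul_self hS
  exact quadForm_transpose_mul_self D x ▸ innerSum_self_nonneg _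

theorem quadForm_eq_zero_iff {S : Matrix X X ℝ} (hS : S.PosDef) {x : X → E} :
    quadForm S x = 0 ↔ x = 0 := by
  classical
  refine ⟨fun h => ?_, fun h => h ▸ quadForm_zero S⟩
  obtain ⟨D, hD⟩ := exists_eq_transpose_mul_self hS.posSemidef
  have hDx : D •ᵥ x = 0 :=
    innerSum_self_eq_zero (by rw [← quadForm_transpose_mul_self, ← hD, h])
  have hSx : S •ᵥ x = 0 := by rw [hD, ← smulVec_smulVec, hDx, smulVec_zero]
  rw [← one_smulVec x, ← Matrix.nonsing_inv_mul S hS.det_pos.ne'.isUnit, ← smulVec_smulVec, hSx,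
    smulVec_zero]

end QuadraticForm

/-! ### Completion of squares -/

section CompletionOfSquares

variable {E X U : Type*} [NormedAddCommGroup E] [InnerProductSpace ℝ E] [Fintype X]
  {S : Matrix X X ℝ} {R : Matrix U U ℝ}

theorem posDef_add_transpose_mul_mul [Finite U] (hS : S.PosSemidef) (B : Matrix X U ℝ)
    (hR : R.PosDef) : (R + Bᵀ * S * B).PosDef := by
  refine hR.add_posSemidef ?_
  rw [← Matrix.conjTranspose_eq_transpose_of_trivial]
  exact hS.conjTranspose_mul_mul_same B

variable [Fintype U] [DecidableEq U]

theorem mul_gain (hS : S.PosSemidef) (A : Matrix X X ℝ) (B : Matrix X U ℝ) (hR : R.PosDef) :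
    (R + Bᵀ * S * B) * gain S A B R = Bᵀ * S * A := by
  have hdet := (posDef_add_transpose_mul_mul hS B hR).det_pos.ne'.isUnit
  simp only [gain, Matrix.mul_assoc] at hdet ⊢
  rw [Matrix.mul_nonsing_inv_cancel_left _ _ hdet]

theorem riccati_eq_sub (hS : S.PosSemidef) (A : Matrix X X ℝ) (B : Matrix X U ℝ)
    (Q : Matrix X X ℝ) (hR : R.PosDef) :
    riccati S A B Q R = Q + Aᵀ * S * A -
      (gain S A B R)ᵀ * (R + Bᵀ * S * B) * gain S A B R := by
  have hG := (isSymm_of_posSemidef (posDef_add_transpose_mul_mul hS B hR).posSemidef).eq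
  have hL : (gain S A B R)ᵀ = Aᵀ * S * B * (R + Bᵀ * S * B)⁻¹ := by
    simp only [gain, Matrix.transpose_mul, Matrix.transpose_transpose,
      Matrix.transpose_nonsing_inv, (isSymm_of_posSemidef hS).eq, Matrix.mul_assoc] at hG ⊢
    rw [hG]
  rw [Matrix.mul_assoc _ (R + _), mul_gain hS A B hR, hL, riccati]
  simp only [Matrix.mul_assoc]

theorem completion_of_squares (hS : S.PosSemidef) (A : Matrix X X ℝ) (B : Matrix X U ℝ)
    (Q : Matrix X X ℝ) (hR : R.PosDef) (x : X → E) (u : U → E) :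
    quadForm Q x + quadForm R u + quadForm S (A •ᵥ x + B •ᵥ u) =
      quadForm (riccati S A B Q R) x +
        quadForm (R + Bᵀ * S * B) (u + gain S A B R •ᵥ x) := by
  have hG := isSymm_of_posSemidef (posDef_add_transpose_mul_mul hS B hR).posSemidef
  have hcross : innerSum u ((R + Bᵀ * S * B) •ᵥ gain S A B R •ᵥ x) =
      innerSum (A •ᵥ x) (S •ᵥ B •ᵥ u) := by
    rw [smulVec_smulVec, mul_gain hS A B hR, innerSum_smulVec_symm (isSymm_of_posSemidef hS),
      innerSum_smulVec_left, smulVec_smulVec, smulVec_smulVec, Matrix.mul_assoc]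
  rw [quadForm_add hG, hcross, quadForm_add (isSymm_of_posSemidef hS), riccati_eq_sub hS A B Q hR,
    quadForm_sub_matrix, quadForm_add_matrix Q, quadForm_add_matrix R, ← quadForm_smulVec,
    ← quadForm_smulVec, ← quadForm_smulVec]
  ring

theorem posSemidef_riccati (hS : S.PosSemidef) (A : Matrix X X ℝ) (B : Matrix X U ℝ)
    {Q : Matrix X X ℝ} (hQ : Q.PosSemidef) (hR : R.PosDef) : (riccati S A B Q R).PosSemidef := by
  have hG := (isSymm_of_posSemidef (posDef_add_transpose_mul_mul hS B hR).posSemidef).eq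
  refine Matrix.PosSemidef.of_dotProduct_mulVec_nonneg ?_ fun x => ?_
  · rw [Matrix.isHermitian_iff_isSymm, riccati_eq_sub hS A B Q hR, Matrix.IsSymm]
    simp only [Matrix.transpose_sub, Matrix.transpose_add Q, Matrix.transpose_mul,
      Matrix.transpose_transpose, (isSymm_of_posSemidef hS).eq, (isSymm_of_posSemidef hQ).eq,
      Matrix.mul_assoc] at hG ⊢
    rw [hG]
  · have hsq := completion_of_squares hS A B Q hR x (-(gain S A B R •ᵥ x))
    rw [neg_add_cancel, quadForm_zero, add_zero] at hsq
    rw [star_trivial, ← quadForm_eq_dotProduct_mulVec, ← hsq]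
    exact add_nonneg (add_nonneg (quadForm_nonneg hQ _) (quadForm_nonneg hR.posSemidef _))
      (quadForm_nonneg hS _)

theorem posSemidef_riccatiSol (A : Matrix X X ℝ) (B : Matrix X U ℝ) {Q QT : Matrix X X ℝ}
    (hQ : Q.PosSemidef) (hQT : QT.PosSemidef) (hR : R.PosDef) (k : ℕ) :
    (riccatiSol A B Q QT R k).PosSemidef := by
  induction k with
  | zero => exact hQT
  | succ k ih => exact posSemidef_riccati ih A B hQ hR

end CompletionOfSquares

/-- The data of a linear quadratic regulator with horizon `N`: dynamics `x(t+1) = A x(t) + B u(t)`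
plus noise, running costs `Q`, `R` at the instants `t < N` and terminal cost `QT`. -/
structure Regulator (X U : Type*) where
  N : ℕ
  A : Matrix X X ℝ
  B : Matrix X U ℝ
  Q : Matrix X X ℝ
  QT : Matrix X X ℝ
  R : Matrix U U ℝ
  Q_posSemidef : Q.PosSemidef
  QT_posSemidef : QT.PosSemidef
  R_posDef : R.PosDef

namespace Regulator

variable {E X U : Type*} [NormedAddCommGroup E] [InnerProductSpace ℝ E] [Fintype X] [Fintype U]

/-- The states and controls of a regulator take values in vectors with entries in an inner product
space `E`.  In a trajectory with initial state `x₀` and noise `w` the control at time `t` has its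
entries in `H t`, the space of what the controller knows at time `t`. -/
structure IsTrajectory (ρ : Regulator X U) (x₀ : X → E) (w : ℕ → X → E)
    (H : ℕ → Submodule ℝ E) (x : ℕ → X → E) (u : ℕ → U → E) : Prop where
  init : x 0 = x₀
  step : ∀ t < ρ.N, x (t + 1) = ρ.A •ᵥ x t + ρ.B •ᵥ u t + w t
  control_mem : ∀ t < ρ.N, ∀ i, u t i ∈ H t

/-- The quadratic cost of a state and a control process. -/
def cost (ρ : Regulator X U) (x : ℕ → X → E) (u : ℕ → U → E) : ℝ :=
  ∑ t ∈ Finset.range ρ.N, (quadForm ρ.Q (x t) + quadForm ρ.R (u t)) + quadForm ρ.QT (x ρ.N)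

theorem IsTrajectory.sub_mem {ρ : Regulator X U} {x₀ : X → E} {w : ℕ → X → E}
    {H : ℕ → Submodule ℝ E} (hH : Monotone H) {x x' : ℕ → X → E} {u u' : ℕ → U → E}
    (h : ρ.IsTrajectory x₀ w H x u) (h' : ρ.IsTrajectory x₀ w H x' u') {t : ℕ} (ht : t ≤ ρ.N)
    (i : X) : (x t - x' t) i ∈ H t := by
  induction t generalizing i with
  | zero => simp [h.init, h'.init]
  | succ t ih =>
    have hstep : x (t + 1) - x' (t + 1) = ρ.A •ᵥ (x t - x' t) + ρ.B •ᵥ (u t - u' t) := by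
      rw [h.step t (by omega), h'.step t (by omega), smulVec_sub, smulVec_sub]
      abel
    rw [hstep]
    exact hH t.le_succ (add_mem (smulVec_mem _ (ih (by omega)) i)
      (smulVec_mem _ (fun j => (H t).sub_mem (h.control_mem t ht j) (h'.control_mem t ht j)) i))

variable [DecidableEq U] (ρ : Regulator X U)

/-- The matrix `S(t)` of the quadratic cost to go, `t ≤ N`. -/
def costToGo (t : ℕ) : Matrix X X ℝ := riccatiSol ρ.A ρ.B ρ.Q ρ.QT ρ.R (ρ.N - t)

/-- The optimal gain `L(t)`, `t < N`. -/
def optimalGain (t : ℕ) : Matrix U X ℝ := gain (ρ.costToGo (t + 1)) ρ.A ρ.B ρ.R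

/-- The matrix `R + Bᵀ S(t+1) B`, which weighs the deviations from the optimal control at time
`t`. -/
def deviationWeight (t : ℕ) : Matrix U U ℝ := ρ.R + ρ.Bᵀ * ρ.costToGo (t + 1) * ρ.B

theorem posSemidef_costToGo (t : ℕ) : (ρ.costToGo t).PosSemidef :=
  posSemidef_riccatiSol _ _ ρ.Q_posSemidef ρ.QT_posSemidef ρ.R_posDef _

theorem posDef_deviationWeight (t : ℕ) : (ρ.deviationWeight t).PosDef :=
  posDef_add_transpose_mul_mul (ρ.posSemidef_costToGo _) ρ.B ρ.R_posDef

theorem costToGo_horizon : ρ.costToGo ρ.N = ρ.QT := by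
  rw [costToGo, Nat.sub_self, riccatiSol]

theorem costToGo_of_lt {t : ℕ} (ht : t < ρ.N) :
    ρ.costToGo t = riccati (ρ.costToGo (t + 1)) ρ.A ρ.B ρ.Q ρ.R := by
  rw [costToGo, show ρ.N - t = (ρ.N - (t + 1)) + 1 by omega, riccatiSol, costToGo]

theorem stage_cost_eq {t : ℕ} (ht : t < ρ.N) (x w : X → E) (u : U → E) :
    quadForm ρ.Q x + quadForm ρ.R u =
      quadForm (ρ.costToGo t) x - quadForm (ρ.costToGo (t + 1)) (ρ.A •ᵥ x + ρ.B •ᵥ u + w) +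
        quadForm (ρ.deviationWeight t) (u + ρ.optimalGain t •ᵥ x) +
        2 * innerSum (ρ.A •ᵥ x + ρ.B •ᵥ u) (ρ.costToGo (t + 1) •ᵥ w) +
        quadForm (ρ.costToGo (t + 1)) w := by
  have hS := ρ.posSemidef_costToGo (t + 1)
  rw [quadForm_add (isSymm_of_posSemidef hS) (ρ.A •ᵥ x + ρ.B •ᵥ u) w, ρ.costToGo_of_lt ht]
  have hsq := completion_of_squares hS ρ.A ρ.B ρ.Q ρ.R_posDef x u
  rw [deviationWeight, optimalGain]
  linarith

section Estimation

variable (w : ℕ → X → E) (H : ℕ → Submodule ℝ E) [∀ t, (H t).HasOrthogonalProjection]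

/-- The deviation `u(t) + L(t) x̂(t)` of a control from the certainty equivalent feedback, in which
`x̂(t)` is the projection of the state onto the information space `H t`. -/
def residual (x : ℕ → X → E) (u : ℕ → U → E) (t : ℕ) : U → E :=
  u t + ρ.optimalGain t •ᵥ fun i => (H t).starProjection (x t i)

/-- The contribution of the estimation error and of the noise to the cost at time `t`. -/
def estimationLoss (x : ℕ → X → E) (t : ℕ) : ℝ :=
  quadForm (ρ.deviationWeight t)
      (ρ.optimalGain t •ᵥ fun i => x t i - (H t).starProjection (x t i)) +
    2 * innerSum (ρ.A •ᵥ x t) (ρ.costToGo (t + 1) •ᵥ w t) +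
    quadForm (ρ.costToGo (t + 1)) (w t)

/-- The total weight of the deviations from the certainty equivalent feedback. -/
def excess (x : ℕ → X → E) (u : ℕ → U → E) : ℝ :=
  ∑ t ∈ Finset.range ρ.N, quadForm (ρ.deviationWeight t) (ρ.residual H x u t)

theorem excess_nonneg (x : ℕ → X → E) (u : ℕ → U → E) : 0 ≤ ρ.excess H x u :=
  Finset.sum_nonneg fun t _ => quadForm_nonneg (ρ.posDef_deviationWeight t).posSemidef _

theorem excess_eq_zero_iff {x : ℕ → X → E} {u : ℕ → U → E} :
    ρ.excess H x u = 0 ↔ ∀ t < ρ.N, ρ.residual H x u t = 0 := by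
  rw [excess, Finset.sum_eq_zero_iff_of_nonneg fun t _ =>
    quadForm_nonneg (ρ.posDef_deviationWeight t).posSemidef _]
  simp only [Finset.mem_range, quadForm_eq_zero_iff (ρ.posDef_deviationWeight _)]

variable {ρ w H} {x₀ : X → E}

theorem IsTrajectory.stage_cost_eq {x : ℕ → X → E} {u : ℕ → U → E}
    (h : ρ.IsTrajectory x₀ w H x u) {t : ℕ} (ht : t < ρ.N) (hw : ∀ i, w t i ∈ (H t)ᗮ) :
    quadForm ρ.Q (x t) + quadForm ρ.R (u t) =
      quadForm (ρ.costToGo t) (x t) - quadForm (ρ.costToGo (t + 1)) (x (t + 1)) +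
        (quadForm (ρ.deviationWeight t) (ρ.residual H x u t) + ρ.estimationLoss w H x t) := by
  have hsplit : u t + ρ.optimalGain t •ᵥ x t = ρ.residual H x u t +
      ρ.optimalGain t •ᵥ fun i => x t i - (H t).starProjection (x t i) := by
    rw [residual, add_assoc, ← smulVec_add]
    congr 2
    funext i
    simp
  have hnoise : innerSum (ρ.B •ᵥ u t) (ρ.costToGo (t + 1) •ᵥ w t) = 0 :=
    innerSum_eq_zero_of_mem_orthogonal (smulVec_mem _ (h.control_mem t ht)) (smulVec_mem _ hw)
  have hresidual : ∀ i, ρ.residual H x u t i ∈ H t := fun i =>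
    add_mem (h.control_mem t ht i)
      (smulVec_mem _ (fun _ => Submodule.starProjection_apply_mem _ _) i)
  rw [ρ.stage_cost_eq ht (x t) (w t) (u t), ← h.step t ht, hsplit,
    quadForm_add_of_mem_orthogonal (isSymm_of_posSemidef (ρ.posDef_deviationWeight t).posSemidef)
      hresidual (smulVec_mem _ fun _ => Submodule.sub_starProjection_mem_orthogonal _),
    innerSum_add_left, hnoise, estimationLoss]
  ring

theorem IsTrajectory.cost_eq {x : ℕ → X → E} {u : ℕ → U → E}
    (h : ρ.IsTrajectory x₀ w H x u) (hw : ∀ t < ρ.N, ∀ i, w t i ∈ (H t)ᗮ) :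
    ρ.cost x u = quadForm (ρ.costToGo 0) x₀ + ρ.excess H x u +
      ∑ t ∈ Finset.range ρ.N, ρ.estimationLoss w H x t := by
  have hstage := fun t (ht : t ∈ Finset.range ρ.N) =>
    h.stage_cost_eq (Finset.mem_range.1 ht) (hw t (Finset.mem_range.1 ht))
  rw [cost, Finset.sum_congr rfl hstage, Finset.sum_add_distrib, Finset.sum_add_distrib,
    Finset.sum_range_sub' fun t => quadForm (ρ.costToGo t) (x t), h.init, costToGo_horizon, excess]
  ring

theorem estimationLoss_congr {x x' : ℕ → X → E} {t : ℕ} (hx : ∀ i, (x t - x' t) i ∈ H t)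
    (hw : ∀ i, w t i ∈ (H t)ᗮ) : ρ.estimationLoss w H x t = ρ.estimationLoss w H x' t := by
  have herror : ∀ i, x t i - (H t).starProjection (x t i) =
      x' t i - (H t).starProjection (x' t i) := fun i => by
    have hproj := Submodule.starProjection_eq_self_iff.2 (hx i)
    rw [Pi.sub_apply, map_sub] at hproj
    rwa [sub_eq_sub_iff_sub_eq_sub, eq_comm]
  have hnoise : innerSum (ρ.A •ᵥ x t) (ρ.costToGo (t + 1) •ᵥ w t) =
      innerSum (ρ.A •ᵥ x' t) (ρ.costToGo (t + 1) •ᵥ w t) := by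
    rw [← sub_add_cancel (x t) (x' t), smulVec_add, innerSum_add_left,
      innerSum_eq_zero_of_mem_orthogonal (smulVec_mem _ hx) (smulVec_mem _ hw), zero_add]
  simp only [estimationLoss, herror, hnoise]

theorem IsTrajectory.cost_sub_excess_eq (hH : Monotone H) (hw : ∀ t < ρ.N, ∀ i, w t i ∈ (H t)ᗮ)
    {x x' : ℕ → X → E} {u u' : ℕ → U → E} (h : ρ.IsTrajectory x₀ w H x u)
    (h' : ρ.IsTrajectory x₀ w H x' u') :
    ρ.cost x u - ρ.excess H x u = ρ.cost x' u' - ρ.excess H x' u' := by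
  have hloss : ∀ t ∈ Finset.range ρ.N, ρ.estimationLoss w H x t = ρ.estimationLoss w H x' t :=
    fun t ht => estimationLoss_congr (h.sub_mem hH h' (Finset.mem_range.1 ht).le)
      (hw t (Finset.mem_range.1 ht))
  rw [h.cost_eq hw, h'.cost_eq hw, Finset.sum_congr rfl hloss]
  ring

end Estimation

end Regulator

/-! ### Block structure -/

section Blocks

variable {n : ℕ} {d e : Fin (n + 1) → ℕ} {V : Type*}

/-- The block of a stacked vector that belongs to agent `j`. -/
abbrev block (x : Stacked d → V) (j : Fin (n + 1)) : Fin (d j) → V := fun a => x ⟨j, a⟩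

/-- The stacked vector with block `0` for the major agent and given blocks for the minor agents. -/
def stackMinor [Zero V] (f : ∀ i : Fin n, Fin (d i.succ) → V) : Stacked d → V := fun p =>
  Fin.cases (motive := fun j => Fin (d j) → V) 0 f p.1 p.2

@[simp]
theorem stackMinor_zero [Zero V] (f : ∀ i : Fin n, Fin (d i.succ) → V) (a : Fin (d 0)) :
    stackMinor f ⟨0, a⟩ = 0 := rfl

@[simp]
theorem stackMinor_succ [Zero V] (f : ∀ i : Fin n, Fin (d i.succ) → V) (i : Fin n)
    (a : Fin (d i.succ)) : stackMinor f ⟨i.succ, a⟩ = f i a := rfl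

theorem forall_stacked {p : Stacked d → Prop} :
    (∀ q, p q) ↔ (∀ a, p ⟨0, a⟩) ∧ ∀ (i : Fin n) (a), p ⟨i.succ, a⟩ := by
  rw [Sigma.forall, Fin.forall_fin_succ]

theorem posSemidef_diagBlock {S : Matrix (Stacked d) (Stacked d) ℝ} (hS : S.PosSemidef)
    (i : Fin (n + 1)) : (diagBlock S i).PosSemidef :=
  hS.submatrix (Sigma.mk i)

theorem posDef_diagBlock {S : Matrix (Stacked d) (Stacked d) ℝ} (hS : S.PosDef)
    (i : Fin (n + 1)) : (diagBlock S i).PosDef :=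
  hS.submatrix sigma_mk_injective

/-- The sparsity pattern of the system matrices: the only nonzero blocks are the diagonal ones and
those in the block column of the major agent. -/
def IsSparse (A : Matrix (Stacked d) (Stacked e) ℝ) : Prop :=
  ∀ i j : Fin (n + 1), i ≠ j → j ≠ 0 → ∀ a b, A ⟨i, a⟩ ⟨j, b⟩ = 0

variable [AddCommGroup V] [Module ℝ V] {A : Matrix (Stacked d) (Stacked e) ℝ}

theorem IsSparse.smulVec_major (hA : IsSparse A) (x : Stacked e → V) (a : Fin (d 0)) :
    (A •ᵥ x) ⟨0, a⟩ = (diagBlock A 0 •ᵥ block x 0) a := by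
  simp only [smulVec]
  rw [Fintype.sum_sigma, Fin.sum_univ_succ]
  simp [hA 0 _ (Fin.succ_ne_zero _).symm (Fin.succ_ne_zero _), diagBlock]

theorem IsSparse.smulVec_minor (hA : IsSparse A) (x : Stacked e → V) (i : Fin n)
    (a : Fin (d i.succ)) :
    (A •ᵥ x) ⟨i.succ, a⟩ = ∑ b, A ⟨i.succ, a⟩ ⟨0, b⟩ • x ⟨0, b⟩ +
      (diagBlock A i.succ •ᵥ block x i.succ) a := by
  simp only [smulVec]
  rw [Fintype.sum_sigma, Fin.sum_univ_succ, Finset.sum_eq_single i]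
  · rfl
  · exact fun j _ hj => Finset.sum_eq_zero fun b _ => by
      rw [hA _ _ (fun h => hj (Fin.succ_injective _ h).symm) (Fin.succ_ne_zero _), zero_smul]
  · simp

theorem IsSparse.smulVec_major_mem (hA : IsSparse A) {K : Submodule ℝ V} {x : Stacked e → V}
    (h0 : ∀ b, x ⟨0, b⟩ ∈ K) (a : Fin (d 0)) : (A •ᵥ x) ⟨0, a⟩ ∈ K := by
  rw [hA.smulVec_major]
  exact smulVec_mem _ h0 a

theorem IsSparse.smulVec_minor_mem (hA : IsSparse A) {K : Submodule ℝ V} {x : Stacked e → V}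
    {i : Fin n} (h0 : ∀ b, x ⟨0, b⟩ ∈ K) (hi : ∀ b, x ⟨i.succ, b⟩ ∈ K) (a : Fin (d i.succ)) :
    (A •ᵥ x) ⟨i.succ, a⟩ ∈ K := by
  rw [hA.smulVec_minor]
  exact add_mem (sum_mem fun b _ => K.smul_mem _ (h0 b)) (smulVec_mem _ hi a)

end Blocks

section Projections

variable {E : Type*} [NormedAddCommGroup E] [InnerProductSpace ℝ E] {F K L : Submodule ℝ E}

theorem orthogonal_inf_sup_eq (h : K ≤ Fᗮ) : Fᗮ ⊓ (F ⊔ K) = K := by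
  rw [sup_comm, inf_comm, sup_inf_assoc_of_le F h, Submodule.inf_orthogonal_eq_bot, sup_bot_eq]

variable [K.HasOrthogonalProjection]

theorem starProjection_add_of_mem {x y : E} (hx : x ∈ K) (hy : y ∈ Kᗮ) :
    K.starProjection (x + y) = x := by
  rw [map_add, Submodule.starProjection_eq_self_iff.2 hx,
    (Submodule.starProjection_apply_eq_zero_iff _).2 hy, add_zero]

theorem starProjection_congr {x y : E} (h : x - y ∈ Kᗮ) :
    K.starProjection x = K.starProjection y := by
  rw [← sub_eq_zero, ← map_sub, (Submodule.starProjection_apply_eq_zero_iff _).2 h]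

theorem sub_starProjection_mem_of_mem_sup (hF : F ≤ Kᗮ) {x : E}
    (hx : x ∈ K ⊔ F) : x - K.starProjection x ∈ F := by
  obtain ⟨y, hy, z, hz, rfl⟩ := Submodule.mem_sup.1 hx
  rwa [starProjection_add_of_mem hy (hF hz), add_sub_cancel_left]

theorem starProjection_mem_of_mem_sup (hL : L ≤ K) (hF : F ≤ Kᗮ) {x : E}
    (hx : x ∈ L ⊔ F) : K.starProjection x ∈ L := by
  obtain ⟨y, hy, z, hz, rfl⟩ := Submodule.mem_sup.1 hx
  rwa [starProjection_add_of_mem (hL hy) (hF hz)]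

theorem starProjection_mem_orthogonal_of_le (hF : F ≤ K) {x : E}
    (hx : x ∈ Fᗮ) : K.starProjection x ∈ Fᗮ := by
  rw [← sub_sub_cancel x (K.starProjection x)]
  exact sub_mem hx (Submodule.orthogonal_le hF (Submodule.sub_starProjection_mem_orthogonal x))

theorem starProjection_eq_of_eq_sup [L.HasOrthogonalProjection]
    (hL : L = F ⊔ K) (hK : K ≤ Fᗮ) {x : E} (hx : x ∈ Fᗮ) :
    L.starProjection x = K.starProjection x := by
  refine Submodule.eq_starProjection_of_mem_orthogonal ?_ ?_
  · exact hL ▸ Submodule.mem_sup_right (Submodule.starProjection_apply_mem _ _)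
  · rw [hL, ← Submodule.inf_orthogonal]
    exact ⟨sub_mem hx (hK (Submodule.starProjection_apply_mem _ _)),
      Submodule.sub_starProjection_mem_orthogonal x⟩

end Projections

section OrthogonalBlocks

variable {n : ℕ} {d : Fin (n + 1) → ℕ} {E : Type*} [NormedAddCommGroup E]
  [InnerProductSpace ℝ E] {G : Fin n → Submodule ℝ E}

theorem quadForm_stackMinor (S : Matrix (Stacked d) (Stacked d) ℝ)
    (hG : ∀ i j, i ≠ j → G i ⟂ G j) {y : ∀ i : Fin n, Fin (d i.succ) → E}
    (hy : ∀ i a, y i a ∈ G i) :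
    quadForm S (stackMinor y) = ∑ i : Fin n, quadForm (diagBlock S i.succ) (y i) := by
  rw [quadForm, innerSum, Fintype.sum_sigma, Fin.sum_univ_succ]
  simp only [stackMinor_zero, inner_zero_left, Finset.sum_const_zero, zero_add]
  refine Finset.sum_congr rfl fun i _ => Finset.sum_congr rfl fun a _ => ?_
  simp only [smulVec, inner_sum]
  rw [Fintype.sum_sigma, Fin.sum_univ_succ, Finset.sum_eq_single i]
  · simp [diagBlock]
  · intro j _ hj
    refine Finset.sum_eq_zero fun b _ => ?_
    rw [inner_smul_right, stackMinor_succ, stackMinor_succ,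
      (hG i j hj.symm).inner_eq (hy i a) (hy j b), mul_zero]
  · simp

theorem quadForm_eq_starProjection_add {K : Submodule ℝ E} [K.HasOrthogonalProjection]
    {S : Matrix (Stacked d) (Stacked d) ℝ}
    (hS : S.PosSemidef) {x : Stacked d → E} (hG : ∀ i j, i ≠ j → G i ⟂ G j)
    (hK : ∀ i, G i ≤ Kᗮ) (h0 : ∀ a, x ⟨0, a⟩ ∈ K) (hx : ∀ i a, x ⟨Fin.succ i, a⟩ ∈ K ⊔ G i) :
    quadForm S x = quadForm S (fun p => K.starProjection (x p)) +
      ∑ i : Fin n, quadForm (diagBlock S i.succ)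
        fun a => x ⟨i.succ, a⟩ - K.starProjection (x ⟨i.succ, a⟩) := by
  have hrest : (fun p => x p - K.starProjection (x p)) =
      stackMinor fun i a => x ⟨i.succ, a⟩ - K.starProjection (x ⟨i.succ, a⟩) := by
    refine funext (forall_stacked.2 ⟨fun a => ?_, fun i a => rfl⟩)
    rw [Submodule.starProjection_eq_self_iff.2 (h0 a), sub_self, stackMinor_zero]
  rw [← quadForm_stackMinor S hG fun i a => sub_starProjection_mem_of_mem_sup (hK i) (hx i a),
    ← hrest, ← quadForm_add_of_mem_orthogonal (isSymm_of_posSemidef hS) (K := K)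
      (fun p => Submodule.starProjection_apply_mem _ _)
      (fun p => Submodule.sub_starProjection_mem_orthogonal _)]
  congr 1
  funext p
  simp

end OrthogonalBlocks

namespace Model

variable {n : ℕ} (M : Model n)

theorem isSparse_A : IsSparse M.A := M.A_sparse

theorem isSparse_B : IsSparse M.B := M.B_sparse

/-- The regulator of the common parts of the state and the control.  Its gains are `L^c`. -/
def commonRegulator : Regulator (Stacked M.dx) (Stacked M.du) where
  N := M.N
  A := M.A
  B := M.B
  Q := M.Q
  QT := M.QT
  R := M.R
  Q_posSemidef := M.Q_posSemidef
  QT_posSemidef := M.QT_posSemidef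
  R_posDef := M.R_posDef

/-- The regulator of the local parts of the state and the control of a minor agent.  Its gains are
`L^ℓ_i`. -/
def localRegulator (i : Fin n) : Regulator (Fin (M.dx i.succ)) (Fin (M.du i.succ)) where
  N := M.N
  A := diagBlock M.A i.succ
  B := diagBlock M.B i.succ
  Q := diagBlock M.Q i.succ
  QT := diagBlock M.QT i.succ
  R := diagBlock M.R i.succ
  Q_posSemidef := posSemidef_diagBlock M.Q_posSemidef _
  QT_posSemidef := posSemidef_diagBlock M.QT_posSemidef _
  R_posDef := posDef_diagBlock M.R_posDef _

end Model

/-! ### Abstract information structures -/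

/-- The information of the agents when none of it depends on the controls: at time `t` the major
agent can use the space `common t` and minor agent `i` the space `common t ⊔ loc i t`.  The
subspace `agent i` carries all the randomness that enters through minor agent `i`. -/
structure InformationStructure {n : ℕ} (M : Model n) (E : Type*) [NormedAddCommGroup E]
    [InnerProductSpace ℝ E] where
  x₀ : Stacked M.dx → E
  w : ℕ → Stacked M.dx → E
  common : ℕ → Submodule ℝ E
  loc : Fin n → ℕ → Submodule ℝ E
  agent : Fin n → Submodule ℝ E
  hasOrthogonalProjection_common : ∀ t, (common t).HasOrthogonalProjection
  hasOrthogonalProjection_loc : ∀ i t, (loc i t).HasOrthogonalProjection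
  common_mono : Monotone common
  loc_mono : ∀ i, Monotone (loc i)
  loc_le_agent : ∀ i, ∀ t < M.N, loc i t ≤ agent i
  agent_le_orthogonal_common : ∀ i, agent i ≤ (common M.N)ᗮ
  isOrtho_agent : ∀ i j, i ≠ j → agent i ⟂ agent j
  x₀_major_mem : ∀ a, x₀ ⟨0, a⟩ ∈ common 0
  x₀_minor_mem : ∀ (i : Fin n) (a), x₀ ⟨i.succ, a⟩ ∈ agent i
  w_major_mem : ∀ t < M.N, ∀ a, w t ⟨0, a⟩ ∈ common (t + 1)
  w_major_mem_orthogonal : ∀ t < M.N, ∀ a, w t ⟨0, a⟩ ∈ (common t)ᗮ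
  w_minor_mem : ∀ t < M.N, ∀ (i : Fin n) (a), w t ⟨i.succ, a⟩ ∈ agent i
  w_minor_mem_orthogonal : ∀ t < M.N, ∀ (i : Fin n) (a), w t ⟨i.succ, a⟩ ∈ (loc i t)ᗮ

namespace InformationStructure

variable {n : ℕ} {M : Model n} {E : Type*} [NormedAddCommGroup E] [InnerProductSpace ℝ E]
  (I : InformationStructure M E)

instance (t : ℕ) : (I.common t).HasOrthogonalProjection := I.hasOrthogonalProjection_common t

instance (i : Fin n) (t : ℕ) : (I.loc i t).HasOrthogonalProjection :=
  I.hasOrthogonalProjection_loc i t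

/-- The control actions that the agents can take at time `t`. -/
structure IsAdmissible (t : ℕ) (u : Stacked M.du → E) : Prop where
  major_mem : ∀ a, u ⟨0, a⟩ ∈ I.common t
  minor_mem : ∀ (i : Fin n) (a), u ⟨i.succ, a⟩ ∈ I.common t ⊔ I.loc i t

/-- The state process `x` results from the admissible controls `u`. -/
structure IsTrajectory (x : ℕ → Stacked M.dx → E) (u : ℕ → Stacked M.du → E) : Prop where
  init : x 0 = I.x₀
  step : ∀ t < M.N, x (t + 1) = M.A •ᵥ x t + M.B •ᵥ u t + I.w t
  admissible : ∀ t < M.N, I.IsAdmissible t (u t)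

section Splitting

variable {d : Fin (n + 1) → ℕ}

/-- The part of a stacked vector that is common knowledge. -/
def commonPart (x : Stacked d → E) : Stacked d → E := fun p => (I.common M.N).starProjection (x p)

/-- The part of the block of a minor agent that is orthogonal to the common knowledge. -/
def localPart (x : Stacked d → E) (i : Fin n) : Fin (d i.succ) → E :=
  block x i.succ - block (I.commonPart x) i.succ

theorem commonPart_add (x y : Stacked d → E) :
    I.commonPart (x + y) = I.commonPart x + I.commonPart y :=
  funext fun _ => map_add _ _ _

theorem commonPart_smulVec {e : Fin (n + 1) → ℕ} (A : Matrix (Stacked d) (Stacked e) ℝ)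
    (x : Stacked e → E) : I.commonPart (A •ᵥ x) = A •ᵥ I.commonPart x :=
  funext fun p => map_smulVec (I.common M.N).starProjection.toLinearMap A x p

theorem localPart_add (x y : Stacked d → E) (i : Fin n) :
    I.localPart (x + y) i = I.localPart x i + I.localPart y i := by
  simp only [localPart, commonPart_add]
  exact add_sub_add_comm _ _ _ _

theorem commonPart_apply_of_mem {t : ℕ} (ht : t ≤ M.N) {x : Stacked d → E} {p : Stacked d}
    (hx : x p ∈ I.common t) : I.commonPart x p = x p :=
  Submodule.starProjection_eq_self_iff.2 (I.common_mono ht hx)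

theorem loc_le_orthogonal_common (i : Fin n) {t : ℕ} (ht : t < M.N) :
    I.loc i t ≤ (I.common M.N)ᗮ :=
  (I.loc_le_agent i t ht).trans (I.agent_le_orthogonal_common i)

theorem localPart_smulVec {e : Fin (n + 1) → ℕ} {A : Matrix (Stacked d) (Stacked e) ℝ}
    (hA : IsSparse A) {t : ℕ} (ht : t ≤ M.N) {x : Stacked e → E}
    (hx : ∀ a, x ⟨0, a⟩ ∈ I.common t) (i : Fin n) :
    I.localPart (A •ᵥ x) i = diagBlock A i.succ •ᵥ I.localPart x i := by
  funext a
  rw [localPart, commonPart_smulVec, localPart, smulVec_sub]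
  simp only [Pi.sub_apply, block, hA.smulVec_minor, I.commonPart_apply_of_mem ht (hx _)]
  exact add_sub_add_left_eq_sub _ _ _

theorem commonPart_mem {t : ℕ} (ht : t ≤ M.N) {x : Stacked d → E} {G : Fin n → Submodule ℝ E}
    (hG : ∀ i, G i ≤ (I.common M.N)ᗮ) (h0 : ∀ a, x ⟨0, a⟩ ∈ I.common t)
    (hx : ∀ (i : Fin n) (a), x ⟨i.succ, a⟩ ∈ I.common t ⊔ G i) (p : Stacked d) :
    I.commonPart x p ∈ I.common t := by
  revert p
  refine forall_stacked.2 ⟨fun a => ?_, fun i a => ?_⟩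
  · rw [I.commonPart_apply_of_mem ht (h0 a)]
    exact h0 a
  · exact starProjection_mem_of_mem_sup (I.common_mono ht) (hG i) (hx i a)

theorem localPart_mem {t : ℕ} (ht : t ≤ M.N) {x : Stacked d → E} {G : Submodule ℝ E}
    (hG : G ≤ (I.common M.N)ᗮ) {i : Fin n} (hx : ∀ a, x ⟨i.succ, a⟩ ∈ I.common t ⊔ G)
    (a : Fin (d i.succ)) : I.localPart x i a ∈ G :=
  sub_starProjection_mem_of_mem_sup hG (sup_le_sup_right (I.common_mono ht) G (hx a))

theorem starProjection_commonPart {t : ℕ} (ht : t ≤ M.N) (x : Stacked d → E) (p : Stacked d) :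
    (I.common t).starProjection (I.commonPart x p) = (I.common t).starProjection (x p) :=
  starProjection_congr <| by
    rw [← neg_mem_iff, neg_sub]
    exact Submodule.orthogonal_le (I.common_mono ht)
      (Submodule.sub_starProjection_mem_orthogonal _)

theorem starProjection_localPart {t : ℕ} (ht : t < M.N) (x : Stacked d → E) (i : Fin n)
    (a : Fin (d i.succ)) :
    (I.loc i t).starProjection (I.localPart x i a) =
      (I.loc i t).starProjection (x ⟨i.succ, a⟩) :=
  starProjection_congr <| by
    rw [← neg_mem_iff, neg_sub, localPart, Pi.sub_apply, sub_sub_cancel]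
    exact (Submodule.isOrtho_iff_le.2 (I.loc_le_orthogonal_common i ht)).symm
      (Submodule.starProjection_apply_mem _ _)

theorem IsAdmissible.ext {t : ℕ} (ht : t ≤ M.N) {u u' : Stacked M.du → E}
    (h : I.IsAdmissible t u) (h' : I.IsAdmissible t u') (hc : I.commonPart u = I.commonPart u')
    (hl : ∀ i, I.localPart u i = I.localPart u' i) : u = u' := by
  refine funext (forall_stacked.2 ⟨fun a => ?_, fun i a => ?_⟩)
  · rw [← I.commonPart_apply_of_mem ht (h.major_mem a), hc,
      I.commonPart_apply_of_mem ht (h'.major_mem a)]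
  · have := congrFun (hl i) a
    rwa [localPart, localPart, hc, Pi.sub_apply, Pi.sub_apply, sub_left_inj] at this

end Splitting

section Trajectories

variable {I} {x x' : ℕ → Stacked M.dx → E} {u u' : ℕ → Stacked M.du → E}

theorem IsTrajectory.state_major_mem (h : I.IsTrajectory x u) {t : ℕ} (ht : t ≤ M.N)
    (a : Fin (M.dx 0)) : x t ⟨0, a⟩ ∈ I.common t := by
  induction t generalizing a with
  | zero => exact h.init ▸ I.x₀_major_mem a
  | succ t ih =>
    rw [h.step t ht]
    have hstep := add_mem (M.isSparse_A.smulVec_major_mem (ih (Nat.le_of_succ_le ht)) a)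
      (M.isSparse_B.smulVec_major_mem (h.admissible t ht).major_mem a)
    exact add_mem (I.common_mono t.le_succ hstep) (I.w_major_mem t ht a)

theorem IsTrajectory.state_minor_mem (h : I.IsTrajectory x u) {t : ℕ} (ht : t ≤ M.N) (i : Fin n)
    (a : Fin (M.dx i.succ)) : x t ⟨i.succ, a⟩ ∈ I.common t ⊔ I.agent i := by
  induction t generalizing a with
  | zero => exact h.init ▸ Submodule.mem_sup_right (I.x₀_minor_mem i a)
  | succ t ih =>
    rw [h.step t ht]
    have hu := h.admissible t ht
    have hstep := add_mem
      (M.isSparse_A.smulVec_minor_mem (fun b => Submodule.mem_sup_left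
        (h.state_major_mem (Nat.le_of_succ_le ht) b)) (ih (Nat.le_of_succ_le ht)) a)
      (M.isSparse_B.smulVec_minor_mem (fun b => Submodule.mem_sup_left (hu.major_mem b))
        (fun b => sup_le_sup_left (I.loc_le_agent i t ht) _ (hu.minor_mem i b)) a)
    exact add_mem (sup_le_sup_right (I.common_mono t.le_succ) _ hstep)
      (Submodule.mem_sup_right (I.w_minor_mem t ht i a))

theorem IsTrajectory.quadForm_state (h : I.IsTrajectory x u) {t : ℕ} (ht : t ≤ M.N)
    {S : Matrix (Stacked M.dx) (Stacked M.dx) ℝ} (hS : S.PosSemidef) :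
    quadForm S (x t) = quadForm S (I.commonPart (x t)) +
      ∑ i : Fin n, quadForm (diagBlock S i.succ) (I.localPart (x t) i) :=
  quadForm_eq_starProjection_add hS I.isOrtho_agent I.agent_le_orthogonal_common
    (fun a => I.common_mono ht (h.state_major_mem ht a))
    (fun i a => sup_le_sup_right (I.common_mono ht) _ (h.state_minor_mem ht i a))

theorem IsTrajectory.quadForm_control (h : I.IsTrajectory x u) {t : ℕ} (ht : t < M.N)
    {S : Matrix (Stacked M.du) (Stacked M.du) ℝ} (hS : S.PosSemidef) :
    quadForm S (u t) = quadForm S (I.commonPart (u t)) +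
      ∑ i : Fin n, quadForm (diagBlock S i.succ) (I.localPart (u t) i) :=
  quadForm_eq_starProjection_add hS I.isOrtho_agent I.agent_le_orthogonal_common
    (fun a => I.common_mono ht.le ((h.admissible t ht).major_mem a))
    (fun i a => sup_le_sup (I.common_mono ht.le) (I.loc_le_agent i t ht)
      ((h.admissible t ht).minor_mem i a))

theorem IsTrajectory.cost_split (h : I.IsTrajectory x u) :
    M.commonRegulator.cost x u =
      M.commonRegulator.cost (fun t => I.commonPart (x t)) (fun t => I.commonPart (u t)) +
        ∑ i, (M.localRegulator i).cost (fun t => I.localPart (x t) i)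
          (fun t => I.localPart (u t) i) := by
  have hstage : ∀ t ∈ Finset.range M.N, quadForm M.Q (x t) + quadForm M.R (u t) =
      (quadForm M.Q (I.commonPart (x t)) + quadForm M.R (I.commonPart (u t))) +
        ∑ i : Fin n, (quadForm (diagBlock M.Q i.succ) (I.localPart (x t) i) +
          quadForm (diagBlock M.R i.succ) (I.localPart (u t) i)) := fun t ht => by
    rw [h.quadForm_state (Finset.mem_range.1 ht).le M.Q_posSemidef,
      h.quadForm_control (Finset.mem_range.1 ht) M.R_posDef.posSemidef, Finset.sum_add_distrib]
    exact add_add_add_comm _ _ _ _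
  simp only [Regulator.cost, Model.commonRegulator, Model.localRegulator]
  rw [Finset.sum_congr rfl hstage, h.quadForm_state le_rfl M.QT_posSemidef,
    Finset.sum_add_distrib (s := Finset.range M.N), Finset.sum_comm (s := Finset.range M.N),
    Finset.sum_add_distrib (s := Finset.univ)]
  ring

theorem IsTrajectory.commonPart (h : I.IsTrajectory x u) :
    M.commonRegulator.IsTrajectory (I.commonPart I.x₀) (fun t => I.commonPart (I.w t)) I.common
      (fun t => I.commonPart (x t)) (fun t => I.commonPart (u t)) where
  init := by rw [h.init]
  step t ht := by
    rw [h.step t ht, commonPart_add, commonPart_add, commonPart_smulVec, commonPart_smulVec]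
    rfl
  control_mem t ht := I.commonPart_mem (Nat.le_of_lt ht)
    (fun i => I.loc_le_orthogonal_common i ht) (h.admissible t ht).major_mem
    (h.admissible t ht).minor_mem

theorem IsTrajectory.localPart (h : I.IsTrajectory x u) (i : Fin n) :
    (M.localRegulator i).IsTrajectory (I.localPart I.x₀ i) (fun t => I.localPart (I.w t) i)
      (I.loc i) (fun t => I.localPart (x t) i) (fun t => I.localPart (u t) i) where
  init := by rw [h.init]
  step t ht := by
    rw [h.step t ht, localPart_add, localPart_add,
      I.localPart_smulVec M.isSparse_A (Nat.le_of_lt ht) (h.state_major_mem (Nat.le_of_lt ht)),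
      I.localPart_smulVec M.isSparse_B (Nat.le_of_lt ht) (h.admissible t ht).major_mem]
    rfl
  control_mem t ht := I.localPart_mem (Nat.le_of_lt ht) (I.loc_le_orthogonal_common i ht)
    ((h.admissible t ht).minor_mem i)

theorem commonPart_w_minor {t : ℕ} (ht : t < M.N) (i : Fin n) (a : Fin (M.dx i.succ)) :
    I.commonPart (I.w t) ⟨i.succ, a⟩ = 0 :=
  (Submodule.starProjection_apply_eq_zero_iff _).2
    (I.agent_le_orthogonal_common i (I.w_minor_mem t ht i a))

theorem commonPart_w_mem_orthogonal {t : ℕ} (ht : t < M.N) (p : Stacked M.dx) :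
    I.commonPart (I.w t) p ∈ (I.common t)ᗮ := by
  revert p
  refine forall_stacked.2 ⟨fun a => ?_, fun i a => ?_⟩
  · rw [I.commonPart_apply_of_mem ht (I.w_major_mem t ht a)]
    exact I.w_major_mem_orthogonal t ht a
  · rw [commonPart_w_minor ht]
    exact zero_mem _

theorem localPart_w_mem_orthogonal {t : ℕ} (ht : t < M.N) (i : Fin n) (a : Fin (M.dx i.succ)) :
    I.localPart (I.w t) i a ∈ (I.loc i t)ᗮ := by
  rw [InformationStructure.localPart, Pi.sub_apply, block, block, commonPart_w_minor ht, sub_zero]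
  exact I.w_minor_mem_orthogonal t ht i a

variable (I) in
/-- The total weight of the deviations of the controls from the certainty equivalent feedback. -/
def excess (x : ℕ → Stacked M.dx → E) (u : ℕ → Stacked M.du → E) : ℝ :=
  M.commonRegulator.excess I.common (fun t => I.commonPart (x t)) (fun t => I.commonPart (u t)) +
    ∑ i, (M.localRegulator i).excess (I.loc i) (fun t => I.localPart (x t) i)
      (fun t => I.localPart (u t) i)

variable (I) in
theorem excess_nonneg (x : ℕ → Stacked M.dx → E) (u : ℕ → Stacked M.du → E) :
    0 ≤ I.excess x u :=
  add_nonneg (Regulator.excess_nonneg _ _ _ _)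
    (Finset.sum_nonneg fun _ _ => Regulator.excess_nonneg _ _ _ _)

theorem IsTrajectory.cost_sub_excess_eq (h : I.IsTrajectory x u) (h' : I.IsTrajectory x' u') :
    M.commonRegulator.cost x u - I.excess x u = M.commonRegulator.cost x' u' - I.excess x' u' := by
  have hcommon := h.commonPart.cost_sub_excess_eq I.common_mono
    (fun t ht => commonPart_w_mem_orthogonal ht) h'.commonPart
  have hlocal := fun i => (h.localPart i).cost_sub_excess_eq (I.loc_mono i)
    (fun t ht => localPart_w_mem_orthogonal ht i) (h'.localPart i)
  have hsum := Finset.sum_congr (rfl : (Finset.univ : Finset (Fin n)) = _) fun i _ => hlocal i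
  rw [Finset.sum_sub_distrib, Finset.sum_sub_distrib] at hsum
  rw [h.cost_split, h'.cost_split, excess, excess, add_sub_add_comm, hcommon, hsum,
    add_sub_add_comm]

end Trajectories

section Feedback

/-- The certainty equivalent feedback: every agent applies the optimal gain to the projection of
the state onto the common information, and minor agents correct it by the optimal local gain
applied to the projection of their state onto their local information. -/
def feedback (t : ℕ) (x : Stacked M.dx → E) : Stacked M.du → E :=
  -(M.Lc t •ᵥ fun p => (I.common t).starProjection (x p)) +
    stackMinor fun i => -(M.Ll i t •ᵥ fun a => (I.loc i t).starProjection (x ⟨i.succ, a⟩))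

theorem neg_Lc_smulVec_mem (t : ℕ) (x : Stacked M.dx → E) (p : Stacked M.du) :
    -(M.Lc t •ᵥ fun q => (I.common t).starProjection (x q)) p ∈ I.common t :=
  neg_mem (smulVec_mem _ (fun _ => Submodule.starProjection_apply_mem _ _) p)

theorem neg_Ll_smulVec_mem (t : ℕ) (x : Stacked M.dx → E) (i : Fin n)
    (a : Fin (M.du i.succ)) :
    -(M.Ll i t •ᵥ fun b => (I.loc i t).starProjection (x ⟨i.succ, b⟩)) a ∈ I.loc i t :=
  neg_mem (smulVec_mem _ (fun _ => Submodule.starProjection_apply_mem _ _) a)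

theorem isAdmissible_feedback (t : ℕ) (x : Stacked M.dx → E) :
    I.IsAdmissible t (I.feedback t x) where
  major_mem _ := add_mem (I.neg_Lc_smulVec_mem t x _) (zero_mem _)
  minor_mem i a := add_mem (Submodule.mem_sup_left (I.neg_Lc_smulVec_mem t x _))
    (Submodule.mem_sup_right (I.neg_Ll_smulVec_mem t x i a))

theorem commonPart_feedback {t : ℕ} (ht : t < M.N) (x : Stacked M.dx → E) :
    I.commonPart (I.feedback t x) = -(M.Lc t •ᵥ fun p => (I.common t).starProjection (x p)) := by
  refine funext fun p => starProjection_add_of_mem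
    (I.common_mono ht.le (I.neg_Lc_smulVec_mem t x p)) ?_
  revert p
  exact forall_stacked.2 ⟨fun _ => zero_mem _, fun i a =>
    I.loc_le_orthogonal_common i ht (I.neg_Ll_smulVec_mem t x i a)⟩

theorem localPart_feedback {t : ℕ} (ht : t < M.N) (x : Stacked M.dx → E) (i : Fin n) :
    I.localPart (I.feedback t x) i =
      -(M.Ll i t •ᵥ fun a => (I.loc i t).starProjection (x ⟨i.succ, a⟩)) := by
  rw [localPart, commonPart_feedback I ht]
  exact funext fun a => add_sub_cancel_left _ _

variable {I} in
theorem IsAdmissible.eq_feedback_iff {t : ℕ} (ht : t < M.N) {u : Stacked M.du → E}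
    (hu : I.IsAdmissible t u) (x : Stacked M.dx → E) :
    u = I.feedback t x ↔
      I.commonPart u = -(M.Lc t •ᵥ fun p => (I.common t).starProjection (x p)) ∧
        ∀ i, I.localPart u i =
          -(M.Ll i t •ᵥ fun a => (I.loc i t).starProjection (x ⟨i.succ, a⟩)) := by
  simp only [← I.commonPart_feedback ht, ← I.localPart_feedback ht]
  exact ⟨fun h => h ▸ ⟨rfl, fun _ => rfl⟩, fun h =>
    hu.ext I ht.le (I.isAdmissible_feedback t x) h.1 h.2⟩

variable {I} {x x' : ℕ → Stacked M.dx → E} {u u' : ℕ → Stacked M.du → E}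

theorem IsTrajectory.excess_eq_zero_iff (h : I.IsTrajectory x u) :
    I.excess x u = 0 ↔ ∀ t < M.N, u t = I.feedback t (x t) := by
  have hlocal : ∀ i ∈ Finset.univ, 0 ≤ (M.localRegulator i).excess (I.loc i)
      (fun t => I.localPart (x t) i) (fun t => I.localPart (u t) i) :=
    fun i _ => Regulator.excess_nonneg _ _ _ _
  rw [excess, add_eq_zero_iff_of_nonneg (Regulator.excess_nonneg _ _ _ _)
      (Finset.sum_nonneg hlocal), Finset.sum_eq_zero_iff_of_nonneg hlocal]
  have hresidual : ∀ t < M.N, u t = I.feedback t (x t) ↔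
      M.commonRegulator.residual I.common (fun t => I.commonPart (x t))
          (fun t => I.commonPart (u t)) t = 0 ∧
        ∀ i, (M.localRegulator i).residual (I.loc i) (fun t => I.localPart (x t) i)
          (fun t => I.localPart (u t) i) t = 0 := fun t ht => by
    simp only [(h.admissible t ht).eq_feedback_iff ht, Regulator.residual, add_eq_zero_iff_eq_neg,
      I.starProjection_commonPart ht.le, I.starProjection_localPart ht]
    rfl
  simp only [Regulator.excess_eq_zero_iff, Finset.mem_univ, true_implies]
  constructor
  · exact fun hzero t ht => (hresidual t ht).2 ⟨hzero.1 t ht, fun i => hzero.2 i t ht⟩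
  · exact fun hu => ⟨fun t ht => ((hresidual t ht).1 (hu t ht)).1,
      fun i t ht => ((hresidual t ht).1 (hu t ht)).2 i⟩

variable (I)

/-- The state process generated by the certainty equivalent feedback. -/
def optimalState : ℕ → Stacked M.dx → E
  | 0 => I.x₀
  | t + 1 => M.A •ᵥ optimalState t + M.B •ᵥ I.feedback t (optimalState t) + I.w t

/-- The control process generated by the certainty equivalent feedback. -/
def optimalControl (t : ℕ) : Stacked M.du → E := I.feedback t (I.optimalState t)

theorem isTrajectory_optimal : I.IsTrajectory I.optimalState I.optimalControl where
  init := rfl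
  step _ _ := rfl
  admissible t _ := I.isAdmissible_feedback t _

variable {I}

theorem IsTrajectory.cost_eq_optimal_add_excess (h : I.IsTrajectory x u) :
    M.commonRegulator.cost x u =
      M.commonRegulator.cost I.optimalState I.optimalControl + I.excess x u := by
  have hoptimal := I.isTrajectory_optimal.excess_eq_zero_iff.2 fun _ _ => rfl
  have hsub := h.cost_sub_excess_eq I.isTrajectory_optimal
  rw [hoptimal, sub_zero] at hsub
  rw [← hsub, sub_add_cancel]

theorem IsTrajectory.optimal_cost_le (h : I.IsTrajectory x u) :
    M.commonRegulator.cost I.optimalState I.optimalControl ≤ M.commonRegulator.cost x u := by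
  rw [h.cost_eq_optimal_add_excess]
  exact le_add_of_nonneg_right (I.excess_nonneg x u)

theorem IsTrajectory.cost_le_optimal_iff (h : I.IsTrajectory x u) :
    M.commonRegulator.cost x u ≤ M.commonRegulator.cost I.optimalState I.optimalControl ↔
      ∀ t < M.N, u t = I.feedback t (x t) := by
  rw [h.cost_eq_optimal_add_excess, add_le_iff_nonpos_right, ← h.excess_eq_zero_iff]
  exact ⟨fun hle => le_antisymm hle (I.excess_nonneg x u), le_of_eq⟩

theorem IsTrajectory.state_eq_optimalState (h : I.IsTrajectory x u)
    (hu : ∀ t < M.N, u t = I.feedback t (x t) ∨ u t = I.optimalControl t) {t : ℕ}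
    (ht : t ≤ M.N) : x t = I.optimalState t := by
  induction t with
  | zero => exact h.init
  | succ t ih =>
    have hx := ih (Nat.le_of_succ_le ht)
    have hcontrol : u t = I.feedback t (I.optimalState t) := by
      simpa only [hx, optimalControl, or_self] using hu t ht
    rw [h.step t ht, hx, hcontrol, optimalState]

theorem IsTrajectory.forall_eq_feedback_iff (h : I.IsTrajectory x u) :
    (∀ t < M.N, u t = I.feedback t (x t)) ↔ ∀ t < M.N, u t = I.optimalControl t := by
  constructor <;> intro hu t ht
  · rw [hu t ht, optimalControl, h.state_eq_optimalState (fun s hs => .inl (hu s hs)) ht.le]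
  · rw [hu t ht, optimalControl, h.state_eq_optimalState (fun s hs => .inr (hu s hs)) ht.le]

end Feedback

section Orthogonality

variable {I} {F : Submodule ℝ E}

theorem feedback_mem_orthogonal {t : ℕ} (ht : t < M.N) (hF : F ≤ I.common t)
    {x : Stacked M.dx → E} (hx : ∀ p, x p ∈ Fᗮ) (p : Stacked M.du) :
    I.feedback t x p ∈ Fᗮ := by
  have hcommon : ∀ q, -(M.Lc t •ᵥ fun p => (I.common t).starProjection (x p)) q ∈ Fᗮ := fun q =>
    neg_mem (smulVec_mem _ (fun p => starProjection_mem_orthogonal_of_le hF (hx p)) q)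
  refine add_mem (hcommon p) ?_
  revert p
  exact forall_stacked.2 ⟨fun _ => zero_mem _, fun i a =>
    Submodule.orthogonal_le (hF.trans (I.common_mono ht.le))
      (I.loc_le_orthogonal_common i ht (I.neg_Ll_smulVec_mem t x i a))⟩

theorem IsTrajectory.state_mem_orthogonal {x : ℕ → Stacked M.dx → E} {u : ℕ → Stacked M.du → E}
    (h : I.IsTrajectory x u) (hF : F ≤ I.common 0) (hx₀ : ∀ p, I.x₀ p ∈ Fᗮ)
    (hw : ∀ t < M.N, ∀ p, I.w t p ∈ Fᗮ) {t : ℕ} (ht : t ≤ M.N)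
    (hu : ∀ s < t, u s = I.feedback s (x s)) (p : Stacked M.dx) : x t p ∈ Fᗮ := by
  induction t generalizing p with
  | zero => exact h.init ▸ hx₀ p
  | succ t ih =>
    have hx := ih (Nat.le_of_succ_le ht) fun s hs => hu s (hs.trans t.lt_succ_self)
    rw [h.step t ht, hu t t.lt_succ_self]
    exact add_mem (add_mem (smulVec_mem _ hx p) (smulVec_mem _
      (feedback_mem_orthogonal ht (hF.trans (I.common_mono t.zero_le)) hx) p)) (hw t ht p)

end Orthogonality

end InformationStructure

/-! ### Control-free information -/

section ControlFree

section FunSpan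

variable {Ω ι κ : Type*}

/-- The coordinates of a random vector, as a vector of random variables. -/
def coords (f : Ω → ι → ℝ) (k : ι) : Ω → ℝ := fun ω => f ω k

/-- The linear span of the coordinates of a random vector. -/
def funSpan (f : Ω → ι → ℝ) : Submodule ℝ (Ω → ℝ) := Submodule.span ℝ (Set.range (coords f))

/-- A random vector with an additional constant coordinate `1`.  The span of its coordinates
consists of the affine functions of the vector. -/
def withOne (f : Ω → ι → ℝ) : Ω → Option ι → ℝ := fun ω k => k.elim 1 (f ω)

theorem coords_mem_funSpan (f : Ω → ι → ℝ) (k : ι) : coords f k ∈ funSpan f :=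
  Submodule.subset_span ⟨k, rfl⟩

theorem funSpan_le_iff {f : Ω → ι → ℝ} {K : Submodule ℝ (Ω → ℝ)} :
    funSpan f ≤ K ↔ ∀ k, coords f k ∈ K := by
  rw [funSpan, Submodule.span_le, Set.range_subset_iff]
  rfl

theorem one_mem_funSpan_withOne (f : Ω → ι → ℝ) : 1 ∈ funSpan (withOne f) :=
  coords_mem_funSpan (withOne f) none

theorem funSpan_le_funSpan_withOne (f : Ω → ι → ℝ) : funSpan f ≤ funSpan (withOne f) :=
  funSpan_le_iff.2 fun k => coords_mem_funSpan (withOne f) (some k)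

theorem funSpan_withOne_le {f : Ω → ι → ℝ} {K : Submodule ℝ (Ω → ℝ)} (hone : 1 ∈ K)
    (hf : funSpan f ≤ K) : funSpan (withOne f) ≤ K :=
  funSpan_le_iff.2 fun
    | none => hone
    | some k => hf (coords_mem_funSpan f k)

theorem coords_mulVec [Fintype κ] (A : Matrix ι κ ℝ) (x : Ω → κ → ℝ) :
    coords (fun ω => A *ᵥ x ω) = A •ᵥ coords x := by
  funext i ω
  simp [coords, smulVec, Matrix.mulVec, dotProduct]

theorem exists_affineMap_of_mem_funSpan_withOne [Finite ι] {f : Ω → ι → ℝ} {g : Ω → ℝ}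
    (hg : g ∈ funSpan (withOne f)) : ∃ φ : (ι → ℝ) →ᵃ[ℝ] ℝ, ∀ ω, g ω = φ (f ω) := by
  have := Fintype.ofFinite ι
  obtain ⟨c, rfl⟩ := (Submodule.mem_span_range_iff_exists_fun ℝ).1 hg
  refine ⟨(∑ k, c (some k) • (LinearMap.proj k : (ι → ℝ) →ₗ[ℝ] ℝ)).toAffineMap +
    AffineMap.const ℝ _ (c none), fun ω => ?_⟩
  simp [coords, withOne, Fintype.sum_option, add_comm]

theorem coords_affineMap_mem [Finite ι] {K : Submodule ℝ (Ω → ℝ)} (hone : 1 ∈ K)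
    {f : Ω → ι → ℝ} (hf : ∀ k, coords f k ∈ K) (φ : (ι → ℝ) →ᵃ[ℝ] (κ → ℝ)) (a : κ) :
    coords (fun ω => φ (f ω)) a ∈ K := by
  classical
  have := Fintype.ofFinite ι
  have hφ : coords (fun ω => φ (f ω)) a =
      (LinearMap.toMatrix' φ.linear •ᵥ coords f) a + φ 0 a • (1 : Ω → ℝ) := by
    rw [← coords_mulVec]
    funext ω
    simp only [coords, LinearMap.toMatrix'_mulVec, Pi.add_apply, Pi.smul_apply, Pi.one_apply,
      smul_eq_mul, mul_one]
    exact congrFun (congrFun φ.decomp (f ω)) a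
  rw [hφ]
  exact add_mem (smulVec_mem _ hf a) (K.smul_mem _ hone)

end FunSpan

theorem linearRecursion_mem {X V : Type*} [Fintype X] [AddCommGroup V] [Module ℝ V]
    {K : Submodule ℝ V} {A : Matrix X X ℝ} {x r : ℕ → X → V} {t : ℕ} (h0 : ∀ a, x 0 a ∈ K)
    (hstep : ∀ s < t, x (s + 1) = A •ᵥ x s + r s) (hr : ∀ s < t, ∀ a, r s a ∈ K) (a : X) :
    x t a ∈ K := by
  induction t generalizing a with
  | zero => exact h0 a
  | succ t ih =>
    rw [hstep t t.lt_succ_self]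
    exact add_mem (smulVec_mem _ (ih (fun s hs => hstep s (hs.trans t.lt_succ_self))
      (fun s hs => hr s (hs.trans t.lt_succ_self))) a) (hr t t.lt_succ_self a)

variable {n : ℕ} {Ω : Type*} {M : Model n} (P : Noise M Ω)

section ControlFreeInformation

/-- The primitive random variables that have entered the state of the major agent by time `t`. -/
def majorPrim (t : ℕ) (ω : Ω) : Fin (M.dx 0) ⊕ (Fin t × Fin (M.dx 0)) → ℝ :=
  Sum.elim (P.init 0 ω) fun p => P.w 0 p.1 ω p.2

/-- The part of the state of a minor agent that is driven by its own primitive random variables. -/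
def freeState (i : Fin n) : ℕ → Ω → Fin (M.dx i.succ) → ℝ
  | 0, ω => P.init i.succ ω
  | t + 1, ω => diagBlock M.A i.succ *ᵥ freeState i t ω + P.w i.succ t ω

/-- The part of the output of a minor agent that is driven by its own primitive random
variables. -/
def freeOutput (i : Fin n) (t : ℕ) (ω : Ω) : Fin (M.dy i) → ℝ :=
  M.C i *ᵥ freeState P i t ω + P.v i t ω

/-- The control-free outputs of a minor agent up to time `t`. -/
def minorPrim (i : Fin n) (t : ℕ) (ω : Ω) : Fin (t + 1) × Fin (M.dy i) → ℝ := fun p =>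
  freeOutput P i p.1 ω p.2

/-- The control-free form of the affine functions of `I_0(t)`. -/
def majorSpan (t : ℕ) : Submodule ℝ (Ω → ℝ) := funSpan (withOne (majorPrim P t))

/-- The control-free form of the affine functions of `I_i(t)`. -/
def minorSpan (i : Fin n) (t : ℕ) : Submodule ℝ (Ω → ℝ) :=
  majorSpan P t ⊔ funSpan (minorPrim P i t)

theorem coords_init_mem_majorPrim (t : ℕ) (a : Fin (M.dx 0)) :
    coords (P.init 0) a ∈ funSpan (majorPrim P t) :=
  coords_mem_funSpan (majorPrim P t) (Sum.inl a)

theorem coords_w_mem_majorPrim {s t : ℕ} (hst : s < t) (a : Fin (M.dx 0)) :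
    coords (P.w 0 s) a ∈ funSpan (majorPrim P t) :=
  coords_mem_funSpan (majorPrim P t) (Sum.inr (⟨s, hst⟩, a))

theorem coords_freeOutput_mem_minorPrim (i : Fin n) {s t : ℕ} (hst : s ≤ t) (b : Fin (M.dy i)) :
    coords (freeOutput P i s) b ∈ funSpan (minorPrim P i t) :=
  coords_mem_funSpan (minorPrim P i t) (⟨s, Nat.lt_succ_of_le hst⟩, b)

theorem monotone_majorSpan : Monotone (majorSpan P) := fun _ t hst =>
  funSpan_withOne_le (one_mem_funSpan_withOne _) <| funSpan_le_iff.2 fun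
    | .inl a => funSpan_le_funSpan_withOne _ (coords_init_mem_majorPrim P t a)
    | .inr (r, a) =>
      funSpan_le_funSpan_withOne _ (coords_w_mem_majorPrim P (r.2.trans_le hst) a)

theorem monotone_minorPrim (i : Fin n) : Monotone fun t => funSpan (minorPrim P i t) :=
  fun _ _ hst => funSpan_le_iff.2 fun (r, b) =>
    coords_freeOutput_mem_minorPrim P i ((Nat.le_of_lt_succ r.2).trans hst) b

theorem monotone_minorSpan (i : Fin n) : Monotone (minorSpan P i) := fun _ _ hst =>
  sup_le_sup (monotone_majorSpan P hst) (monotone_minorPrim P i hst)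

theorem majorSpan_le_minorSpan (i : Fin n) (t : ℕ) : majorSpan P t ≤ minorSpan P i t :=
  le_sup_left

variable (u : Control M Ω)

theorem coords_state_succ (t : ℕ) :
    coords (state P u (t + 1)) =
      M.A •ᵥ coords (state P u t) + M.B •ᵥ coords (u t) + coords (P.W t) := by
  rw [← coords_mulVec, ← coords_mulVec]
  rfl

theorem coords_freeState_succ (i : Fin n) (t : ℕ) :
    coords (freeState P i (t + 1)) =
      diagBlock M.A i.succ •ᵥ coords (freeState P i t) + coords (P.w i.succ t) := by
  rw [← coords_mulVec]
  rfl

theorem coords_freeOutput (i : Fin n) (t : ℕ) :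
    coords (freeOutput P i t) = M.C i •ᵥ coords (freeState P i t) + coords (P.v i t) := by
  rw [← coords_mulVec]
  rfl

/-- The part of the state of a minor agent that is driven by the controls and the major agent. -/
def drivenState (i : Fin n) (t : ℕ) : Fin (M.dx i.succ) → Ω → ℝ :=
  block (coords (state P u t)) i.succ - coords (freeState P i t)

theorem drivenState_zero (i : Fin n) : drivenState P u i 0 = 0 :=
  sub_self _

theorem drivenState_succ (i : Fin n) (t : ℕ) :
    drivenState P u i (t + 1) = diagBlock M.A i.succ •ᵥ drivenState P u i t +
      fun a => ∑ b, M.A ⟨i.succ, a⟩ ⟨0, b⟩ • coords (state P u t) ⟨0, b⟩ +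
        (M.B •ᵥ coords (u t)) ⟨i.succ, a⟩ := by
  funext a
  simp only [drivenState, coords_state_succ, coords_freeState_succ, smulVec_sub, Pi.sub_apply,
    Pi.add_apply, M.isSparse_A.smulVec_minor]
  have hw : coords (P.W t) ⟨i.succ, a⟩ = coords (P.w i.succ t) a := rfl
  rw [hw]
  abel

theorem coords_output_eq_state (i : Fin n) (t : ℕ) :
    coords (output P u i t) =
      M.C i •ᵥ block (coords (state P u t)) i.succ + coords (P.v i t) :=
  congrArg (· + coords (P.v i t)) (coords_mulVec (M.C i) fun ω => block (state P u t ω) i.succ)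

theorem coords_output (i : Fin n) (t : ℕ) :
    coords (output P u i t) =
      M.C i •ᵥ drivenState P u i t + coords (freeOutput P i t) := by
  rw [coords_output_eq_state, coords_freeOutput, drivenState, smulVec_sub]
  abel

end ControlFreeInformation

section Adapted

/-- The components of `v` are affine functions of the control-free information at time `t`. -/
structure IsAdaptedAt (t : ℕ) (v : Ω → Stacked M.du → ℝ) : Prop where
  major_mem : ∀ a, coords v ⟨0, a⟩ ∈ majorSpan P t
  minor_mem : ∀ (i : Fin n) (a), coords v ⟨i.succ, a⟩ ∈ minorSpan P i t

variable {P} {u : Control M Ω} {t : ℕ}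

theorem coords_state_major_mem (hu : ∀ s < t, IsAdaptedAt P s (u s)) (a : Fin (M.dx 0)) :
    coords (state P u t) ⟨0, a⟩ ∈ majorSpan P t := by
  refine linearRecursion_mem (A := diagBlock M.A 0)
    (x := fun s => block (coords (state P u s)) 0)
    (r := fun s => block (M.B •ᵥ coords (u s) + coords (P.W s)) 0)
    (fun a => funSpan_le_funSpan_withOne _ (coords_init_mem_majorPrim P t a)) ?_ ?_ a
  · intro s _
    funext a
    simp only [block, coords_state_succ, add_assoc, Pi.add_apply, M.isSparse_A.smulVec_major]
  · exact fun s hs a => add_mem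
      (M.isSparse_B.smulVec_major_mem
        (fun b => monotone_majorSpan P hs.le ((hu s hs).major_mem b)) a)
      (funSpan_le_funSpan_withOne _ (coords_w_mem_majorPrim P hs a))

theorem coords_majorInfo_mem (hu : ∀ s < t, IsAdaptedAt P s (u s)) (k : M.MajorIdx t) :
    coords (majorInfo P u t) k ∈ majorSpan P t := by
  rcases k with ⟨s, a⟩ | ⟨s, a⟩
  · exact monotone_majorSpan P (Nat.le_of_lt_succ s.2)
      (coords_state_major_mem (fun r hr => hu r (hr.trans_le (Nat.le_of_lt_succ s.2))) a)
  · exact monotone_majorSpan P s.2.le ((hu s s.2).major_mem a)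

theorem drivenState_mem (hu : ∀ s < t, IsAdaptedAt P s (u s)) (i : Fin n)
    (a : Fin (M.dx i.succ)) : drivenState P u i t a ∈ minorSpan P i t := by
  refine linearRecursion_mem (fun a => ?_) (fun s _ => drivenState_succ P u i s)
    (fun s hs a => ?_) a
  · exact drivenState_zero P u i ▸ zero_mem _
  · have hmajor : ∀ b, coords (u s) ⟨0, b⟩ ∈ minorSpan P i t := fun b =>
      monotone_minorSpan P i hs.le (majorSpan_le_minorSpan P i s ((hu s hs).major_mem b))
    have hstate : ∀ b, coords (state P u s) ⟨0, b⟩ ∈ minorSpan P i t := fun b =>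
      monotone_minorSpan P i hs.le (majorSpan_le_minorSpan P i s
        (coords_state_major_mem (fun r hr => hu r (hr.trans hs)) b))
    exact add_mem (sum_mem fun b _ => Submodule.smul_mem _ _ (hstate b))
      (M.isSparse_B.smulVec_minor_mem hmajor
        (fun b => monotone_minorSpan P i hs.le ((hu s hs).minor_mem i b)) a)

theorem coords_output_mem (hu : ∀ s < t, IsAdaptedAt P s (u s)) (i : Fin n) (b : Fin (M.dy i)) :
    coords (output P u i t) b ∈ minorSpan P i t := by
  rw [coords_output]
  exact add_mem (smulVec_mem _ (drivenState_mem hu i) b)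
    (Submodule.mem_sup_right (coords_freeOutput_mem_minorPrim P i le_rfl b))

theorem coords_minorInfo_mem (hu : ∀ s < t, IsAdaptedAt P s (u s)) (i : Fin n)
    (k : M.MinorIdx i t) : coords (minorInfo P u i t) k ∈ minorSpan P i t := by
  rcases k with k | ⟨s, b⟩ | ⟨s, a⟩
  · exact majorSpan_le_minorSpan P i t (coords_majorInfo_mem hu k)
  · exact monotone_minorSpan P i (Nat.le_of_lt_succ s.2)
      (coords_output_mem (fun r hr => hu r (hr.trans_le (Nat.le_of_lt_succ s.2))) i b)
  · exact monotone_minorSpan P i s.2.le ((hu s s.2).minor_mem i a)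

theorem AffineStrategy.isAdaptedAt_act (g : AffineStrategy M)
    (hu : ∀ s < t, IsAdaptedAt P s (u s)) : IsAdaptedAt P t (g.act P u t) where
  major_mem a := coords_affineMap_mem (one_mem_funSpan_withOne _) (coords_majorInfo_mem hu)
    (g.major t) a
  minor_mem i a := coords_affineMap_mem
    (majorSpan_le_minorSpan P i t (one_mem_funSpan_withOne _)) (coords_minorInfo_mem hu i)
    (g.minor i t) a

variable (P) in
theorem AffineStrategy.isAdaptedAt_control (g : AffineStrategy M) (t : ℕ) :
    IsAdaptedAt P t (g.control P t) := by
  induction t using Nat.strong_induction_on with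
  | _ t ih =>
    rw [g.control_eq P t]
    exact g.isAdaptedAt_act ih

end Adapted

section Realization

variable (u : Control M Ω)

theorem coords_state_mem_majorInfo {s t : ℕ} (hst : s ≤ t) (a : Fin (M.dx 0)) :
    coords (state P u s) ⟨0, a⟩ ∈ funSpan (majorInfo P u t) :=
  coords_mem_funSpan (majorInfo P u t) (Sum.inl (⟨s, Nat.lt_succ_of_le hst⟩, a))

theorem coords_control_mem_majorInfo {s t : ℕ} (hst : s < t) (a : Fin (M.du 0)) :
    coords (u s) ⟨0, a⟩ ∈ funSpan (majorInfo P u t) :=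
  coords_mem_funSpan (majorInfo P u t) (Sum.inr (⟨s, hst⟩, a))

theorem funSpan_majorInfo_le_minorInfo (i : Fin n) (t : ℕ) :
    funSpan (majorInfo P u t) ≤ funSpan (minorInfo P u i t) :=
  funSpan_le_iff.2 fun k => coords_mem_funSpan (minorInfo P u i t) (Sum.inl k)

theorem funSpan_majorPrim_le_majorInfo (t : ℕ) :
    funSpan (majorPrim P t) ≤ funSpan (majorInfo P u t) := by
  refine funSpan_le_iff.2 fun
    | .inl a => coords_state_mem_majorInfo P u (Nat.zero_le t) a
    | .inr (s, a) => ?_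
  have hw : coords (P.W s) ⟨0, a⟩ = coords (state P u (s + 1)) ⟨0, a⟩ -
      ((M.A •ᵥ coords (state P u s)) ⟨0, a⟩ + (M.B •ᵥ coords (u s)) ⟨0, a⟩) := by
    rw [coords_state_succ]
    exact (add_sub_cancel_left _ _).symm
  have hmem : coords (P.W s) ⟨0, a⟩ ∈ funSpan (majorInfo P u t) := by
    rw [hw]
    exact sub_mem (coords_state_mem_majorInfo P u s.2 a) (add_mem
      (M.isSparse_A.smulVec_major_mem (fun b => coords_state_mem_majorInfo P u s.2.le b) a)
      (M.isSparse_B.smulVec_major_mem (fun b => coords_control_mem_majorInfo P u s.2 b) a))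
  exact hmem

theorem drivenState_mem_minorInfo (i : Fin n) {s t : ℕ} (hst : s ≤ t) (a : Fin (M.dx i.succ)) :
    drivenState P u i s a ∈ funSpan (minorInfo P u i t) := by
  have hle := funSpan_majorInfo_le_minorInfo P u i t
  refine linearRecursion_mem (fun a => ?_) (fun r _ => drivenState_succ P u i r)
    (fun r hr a => ?_) a
  · exact drivenState_zero P u i ▸ zero_mem _
  · exact add_mem (sum_mem fun b _ => Submodule.smul_mem _ _
        (hle (coords_state_mem_majorInfo P u (hr.le.trans hst) b)))
      (M.isSparse_B.smulVec_minor_mem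
        (fun b => hle (coords_control_mem_majorInfo P u (hr.trans_le hst) b))
        (fun b => coords_mem_funSpan (minorInfo P u i t) (.inr (.inr (⟨r, hr.trans_le hst⟩, b))))
        a)

theorem funSpan_minorPrim_le_minorInfo (i : Fin n) (t : ℕ) :
    funSpan (minorPrim P i t) ≤ funSpan (minorInfo P u i t) := by
  refine funSpan_le_iff.2 fun (s, b) => ?_
  have hfree : coords (freeOutput P i s) b =
      coords (output P u i s) b - (M.C i •ᵥ drivenState P u i s) b := by
    rw [coords_output]
    exact (add_sub_cancel_left _ _).symm
  have hmem : coords (freeOutput P i s) b ∈ funSpan (minorInfo P u i t) := by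
    rw [hfree]
    exact sub_mem (coords_mem_funSpan (minorInfo P u i t) (.inr (.inl (s, b))))
      (smulVec_mem _ (drivenState_mem_minorInfo P u i (Nat.le_of_lt_succ s.2)) b)
  exact hmem

theorem majorSpan_le_majorInfo (t : ℕ) : majorSpan P t ≤ funSpan (withOne (majorInfo P u t)) :=
  funSpan_withOne_le (one_mem_funSpan_withOne _)
    ((funSpan_majorPrim_le_majorInfo P u t).trans (funSpan_le_funSpan_withOne _))

theorem minorSpan_le_minorInfo (i : Fin n) (t : ℕ) :
    minorSpan P i t ≤ funSpan (withOne (minorInfo P u i t)) := by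
  refine sup_le ?_ ((funSpan_minorPrim_le_minorInfo P u i t).trans (funSpan_le_funSpan_withOne _))
  exact (majorSpan_le_majorInfo P u t).trans (funSpan_withOne_le (one_mem_funSpan_withOne _)
    ((funSpan_majorInfo_le_minorInfo P u i t).trans (funSpan_le_funSpan_withOne _)))

theorem AffineStrategy.act_congr (g : AffineStrategy M) {u u' : Control M Ω} {t : ℕ}
    (h : ∀ s < t, u s = u' s) : g.act P u t = g.act P u' t := by
  have hstate : ∀ s : Fin (t + 1), state P u s = state P u' s := fun s =>
    state_congr P fun r hr => h r (hr.trans_le (Nat.le_of_lt_succ s.2))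
  have hcontrol : ∀ s : Fin t, u s = u' s := fun s => h s s.2
  funext ω p
  simp only [act, minorInfo, majorInfo, output, hstate, hcontrol]

theorem exists_control_eq (hu : ∀ t, IsAdaptedAt P t (u t)) :
    ∃ g : AffineStrategy M, g.control P = u := by
  choose φ hφ using fun t a => exists_affineMap_of_mem_funSpan_withOne
    (majorSpan_le_majorInfo P u t ((hu t).major_mem a))
  choose ψ hψ using fun t i a => exists_affineMap_of_mem_funSpan_withOne
    (minorSpan_le_minorInfo P u i t ((hu t).minor_mem i a))
  let g : AffineStrategy M :=
    ⟨fun t => AffineMap.pi (φ t), fun i t => AffineMap.pi (ψ t i)⟩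
  have hact : ∀ t, g.act P u t = u t := fun t => by
    funext ω
    exact funext (forall_stacked.2 ⟨fun a => (hφ t a ω).symm, fun i a => (hψ t i a ω).symm⟩)
  refine ⟨g, funext fun t => ?_⟩
  induction t using Nat.strong_induction_on with
  | _ t ih => rw [g.control_eq P t, g.act_congr P ih, hact t]

end Realization

end ControlFree

/-! ### Square integrable random vectors -/

section SquareIntegrable

variable {Ω ι κ : Type*} [MeasurableSpace Ω] {μ : Measure Ω}

theorem toL2_eq_toLp {f : Ω → ℝ} (hf : MemLp f 2 μ) : toL2 μ f = hf.toLp f :=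
  dif_pos hf

theorem coeFn_toL2 {f : Ω → ℝ} (hf : MemLp f 2 μ) : toL2 μ f =ᵐ[μ] f :=
  toL2_eq_toLp hf ▸ hf.coeFn_toLp

theorem toL2_eq_toL2_iff {f g : Ω → ℝ} (hf : MemLp f 2 μ) (hg : MemLp g 2 μ) :
    toL2 μ f = toL2 μ g ↔ f =ᵐ[μ] g := by
  rw [toL2_eq_toLp hf, toL2_eq_toLp hg, MemLp.toLp_eq_toLp_iff]

theorem toL2_congr_ae {f g : Ω → ℝ} (h : f =ᵐ[μ] g) : toL2 μ f = toL2 μ g := by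
  by_cases hf : MemLp f 2 μ
  · exact (toL2_eq_toL2_iff hf ((memLp_congr_ae h).1 hf)).2 h
  · rw [toL2, toL2, dif_neg hf, dif_neg fun hg => hf ((memLp_congr_ae h).2 hg)]

theorem toL2_add {f g : Ω → ℝ} (hf : MemLp f 2 μ) (hg : MemLp g 2 μ) :
    toL2 μ (f + g) = toL2 μ f + toL2 μ g := by
  rw [toL2_eq_toLp hf, toL2_eq_toLp hg, toL2_eq_toLp (hf.add hg), MemLp.toLp_add]

theorem toL2_coeFn (x : Lp ℝ 2 μ) : toL2 μ x = x :=
  (toL2_eq_toLp (Lp.memLp x)).trans (Lp.toLp_coeFn x (Lp.memLp x))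

theorem toL2_sub {f g : Ω → ℝ} (hf : MemLp f 2 μ) (hg : MemLp g 2 μ) :
    toL2 μ (f - g) = toL2 μ f - toL2 μ g := by
  rw [toL2_eq_toLp hf, toL2_eq_toLp hg, toL2_eq_toLp (hf.sub hg), MemLp.toLp_sub]

theorem toL2_const_smul (c : ℝ) {f : Ω → ℝ} (hf : MemLp f 2 μ) :
    toL2 μ (c • f) = c • toL2 μ f := by
  rw [toL2_eq_toLp hf, toL2_eq_toLp (hf.const_smul c), MemLp.toLp_const_smul]

theorem inner_toL2 {f g : Ω → ℝ} (hf : MemLp f 2 μ) (hg : MemLp g 2 μ) :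
    inner ℝ (toL2 μ f) (toL2 μ g) = ∫ ω, f ω * g ω ∂μ := by
  rw [L2.inner_def]
  refine integral_congr_ae ?_
  filter_upwards [coeFn_toL2 hf, coeFn_toL2 hg] with ω hfω hgω
  rw [hfω, hgω, real_inner_eq_re_inner, RCLike.inner_apply, conj_trivial, mul_comm]
  rfl

/-- The square integrable random variables whose class in `L²(μ)` belongs to `V`. -/
def preimageL2 (V : Submodule ℝ (Lp ℝ 2 μ)) : Submodule ℝ (Ω → ℝ) where
  carrier := {f | MemLp f 2 μ ∧ toL2 μ f ∈ V}
  add_mem' hf hg := ⟨hf.1.add hg.1, toL2_add hf.1 hg.1 ▸ V.add_mem hf.2 hg.2⟩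
  zero_mem' := ⟨MemLp.zero,
    ((toL2_eq_toLp (μ := μ) MemLp.zero).trans (MemLp.toLp_zero _)).symm ▸ V.zero_mem⟩
  smul_mem' c _ hf := ⟨hf.1.const_smul c, toL2_const_smul c hf.1 ▸ V.smul_mem c hf.2⟩

/-- The map that sends a square integrable random variable to its class. -/
def toL2Linear (μ : Measure Ω) : preimageL2 (⊤ : Submodule ℝ (Lp ℝ 2 μ)) →ₗ[ℝ] Lp ℝ 2 μ where
  toFun f := toL2 μ f
  map_add' f g := toL2_add f.2.1 g.2.1
  map_smul' c f := toL2_const_smul c f.2.1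

theorem preimageL2_mono {V V' : Submodule ℝ (Lp ℝ 2 μ)} (h : V ≤ V') :
    preimageL2 V ≤ preimageL2 V' :=
  fun _ hf => ⟨hf.1, h hf.2⟩

/-- The classes in `L²(μ)` of the coordinates of a random vector. -/
def coordsL2 (μ : Measure Ω) (f : Ω → ι → ℝ) (k : ι) : Lp ℝ 2 μ := toL2 μ (coords f k)

theorem coordsL2_mem_spanL2 (f : Ω → ι → ℝ) (k : ι) : coordsL2 μ f k ∈ spanL2 μ f :=
  Submodule.subset_span ⟨k, rfl⟩

theorem spanL2_le_iff {f : Ω → ι → ℝ} {V : Submodule ℝ (Lp ℝ 2 μ)} :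
    spanL2 μ f ≤ V ↔ ∀ k, coordsL2 μ f k ∈ V := by
  rw [spanL2, Submodule.span_le, Set.range_subset_iff]
  rfl

theorem spanL2_withOne (f : Ω → ι → ℝ) :
    spanL2 μ (withOne f) = (ℝ ∙ toL2 μ 1) ⊔ spanL2 μ f := by
  refine le_antisymm (spanL2_le_iff.2 fun k => ?_) (sup_le ?_ (spanL2_le_iff.2 fun k => ?_))
  · cases k with
    | none => exact Submodule.mem_sup_left (Submodule.mem_span_singleton_self _)
    | some k => exact Submodule.mem_sup_right (coordsL2_mem_spanL2 f k)
  · exact (Submodule.span_singleton_le_iff_mem _ _).2 (coordsL2_mem_spanL2 (withOne f) none)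
  · exact coordsL2_mem_spanL2 (withOne f) (some k)

theorem funSpan_le_preimageL2 {f : Ω → ι → ℝ} (hf : ∀ k, MemLp (coords f k) 2 μ) :
    funSpan f ≤ preimageL2 (spanL2 μ f) :=
  funSpan_le_iff.2 fun k => ⟨hf k, coordsL2_mem_spanL2 f k⟩

theorem spanL2_le_of_funSpan_le {f : Ω → ι → ℝ} {V : Submodule ℝ (Lp ℝ 2 μ)}
    (h : funSpan f ≤ preimageL2 V) : spanL2 μ f ≤ V :=
  spanL2_le_iff.2 fun k => (funSpan_le_iff.1 h k).2

theorem exists_mem_funSpan_toL2_eq {f : Ω → ι → ℝ}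
    (hf : ∀ k, MemLp (coords f k) 2 μ) {x : Lp ℝ 2 μ} (hx : x ∈ spanL2 μ f) :
    ∃ g ∈ funSpan f, toL2 μ g = x := by
  have hle : spanL2 μ f ≤ ((funSpan f).comap (preimageL2 ⊤).subtype).map (toL2Linear μ) :=
    spanL2_le_iff.2 fun k => ⟨⟨_, hf k, trivial⟩, coords_mem_funSpan f k, rfl⟩
  obtain ⟨g, hg, hgx⟩ := hle hx
  exact ⟨g, hg, hgx⟩

theorem coordsL2_add {f g : Ω → ι → ℝ} (hf : ∀ k, MemLp (coords f k) 2 μ)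
    (hg : ∀ k, MemLp (coords g k) 2 μ) :
    coordsL2 μ (fun ω => f ω + g ω) = coordsL2 μ f + coordsL2 μ g :=
  funext fun k => toL2_add (hf k) (hg k)

theorem memLp_smulVec [Fintype κ] (A : Matrix ι κ ℝ) {x : κ → Ω → ℝ} (hx : ∀ j, MemLp (x j) 2 μ)
    (i : ι) : MemLp ((A •ᵥ x) i) 2 μ :=
  (smulVec_mem (K := preimageL2 ⊤) A (fun j => ⟨hx j, trivial⟩) i).1

theorem toL2_smulVec [Fintype κ] (A : Matrix ι κ ℝ) {x : κ → Ω → ℝ} (hx : ∀ j, MemLp (x j) 2 μ)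
    (i : ι) : toL2 μ ((A •ᵥ x) i) = (A •ᵥ fun j => toL2 μ (x j)) i := by
  let y : κ → preimageL2 (⊤ : Submodule ℝ (Lp ℝ 2 μ)) := fun j => ⟨x j, hx j, trivial⟩
  have hy : ((A •ᵥ y) i : Ω → ℝ) = (A •ᵥ x) i := map_smulVec (preimageL2 ⊤).subtype A y i
  rw [← hy]
  exact map_smulVec (toL2Linear μ) A y i

theorem coordsL2_mulVec [Fintype κ] (A : Matrix ι κ ℝ) {f : Ω → κ → ℝ}
    (hf : ∀ k, MemLp (coords f k) 2 μ) :
    coordsL2 μ (fun ω => A *ᵥ f ω) = A •ᵥ coordsL2 μ f := by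
  funext i
  rw [coordsL2, coords_mulVec]
  exact toL2_smulVec A hf i

theorem ae_eq_iff_coordsL2_eq [Countable ι] {f g : Ω → ι → ℝ} (hf : ∀ k, MemLp (coords f k) 2 μ)
    (hg : ∀ k, MemLp (coords g k) 2 μ) : f =ᵐ[μ] g ↔ coordsL2 μ f = coordsL2 μ g := by
  simp only [Filter.EventuallyEq, funext_iff, ae_all_iff, coordsL2, toL2_eq_toL2_iff (hf _) (hg _)]
  rfl

theorem ae_eq_neg_mulVec_iff [Countable ι] [Fintype κ] (L : Matrix ι κ ℝ) {f : Ω → ι → ℝ}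
    (hf : ∀ k, MemLp (coords f k) 2 μ) {g : Ω → κ → ℝ} (hg : ∀ k, MemLp (coords g k) 2 μ) :
    (∀ᵐ ω ∂μ, f ω = -(L *ᵥ g ω)) ↔ coordsL2 μ f = -(L •ᵥ coordsL2 μ g) := by
  have hL : ∀ k, MemLp (coords (fun ω => (-L) *ᵥ g ω) k) 2 μ :=
    coords_mulVec (-L) g ▸ memLp_smulVec (-L) hg
  simp only [← neg_mulVec]
  rw [← neg_smulVec, ← coordsL2_mulVec (-L) hg]
  exact ae_eq_iff_coordsL2_eq hf hL

end SquareIntegrable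

section Independence

variable {n : ℕ} {Ω : Type*} {M : Model n}

section Primitives

/-- The agent to which a primitive random vector belongs. -/
def Primitive.agent {N : ℕ} : Primitive n N → Fin (n + 1)
  | .init i => i
  | .w i _ => i
  | .v i _ => i.succ

/-- The primitive random vectors that have been realized when the actions at time `t` are taken:
the process noise `w(t)` only acts after time `t`, the observation noise `v(t)` already at `t`. -/
def Primitive.IsPast {N : ℕ} (t : ℕ) : Primitive n N → Prop
  | .init _ => True
  | .w _ s => s < t
  | .v _ s => s ≤ t

/-- The labels of the primitive random vectors of an agent that are realized by time `t`. -/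
def agentPast (N : ℕ) (j : Fin (n + 1)) (t : ℕ) : Set (Primitive n N) :=
  {p | p.agent = j ∧ p.IsPast t}

theorem agentPast_mono (N : ℕ) (j : Fin (n + 1)) : Monotone (agentPast N j) := by
  rintro s t hst p ⟨hagent, hpast⟩
  refine ⟨hagent, ?_⟩
  cases p with
  | init => trivial
  | w _ r => exact lt_of_lt_of_le hpast hst
  | v _ r => exact le_trans hpast hst

theorem disjoint_agentPast {N : ℕ} {j k : Fin (n + 1)} (h : j ≠ k) (s t : ℕ) :
    Disjoint (agentPast N j s) (agentPast N k t) :=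
  Set.disjoint_left.2 fun _ hj hk => h (hj.1.symm.trans hk.1)

theorem disjoint_singleton_w_agentPast {N t : ℕ} (ht : t < N + 1) (j k : Fin (n + 1)) :
    Disjoint {Primitive.w j ⟨t, ht⟩} (agentPast N k t) :=
  Set.disjoint_singleton_left.2 fun h => lt_irrefl t h.2

variable (P : Noise M Ω)

/-- The coordinates of the primitive random vectors whose labels belong to `s`. -/
def primOn (s : Set (Primitive n M.N)) (ω : Ω) : (Σ p : s, Fin (M.primDim p)) → ℝ :=
  fun k => P.prim k.1 ω k.2

theorem coords_prim_mem {s : Set (Primitive n M.N)} {p : Primitive n M.N} (hp : p ∈ s)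
    (a : Fin (M.primDim p)) : coords (P.prim p) a ∈ funSpan (primOn P s) :=
  coords_mem_funSpan (primOn P s) ⟨⟨p, hp⟩, a⟩

theorem coords_init_mem_agentPast (j : Fin (n + 1)) (t : ℕ) (a : Fin (M.dx j)) :
    coords (P.init j) a ∈ funSpan (primOn P (agentPast M.N j t)) :=
  coords_prim_mem P (s := agentPast M.N j t) (p := .init j) ⟨rfl, trivial⟩ a

theorem coords_w_mem_agentPast (j : Fin (n + 1)) {s t : ℕ} (hs : s ≤ M.N) (hst : s < t)
    (a : Fin (M.dx j)) : coords (P.w j s) a ∈ funSpan (primOn P (agentPast M.N j t)) :=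
  coords_prim_mem P (s := agentPast M.N j t) (p := .w j ⟨s, Nat.lt_succ_of_le hs⟩) ⟨rfl, hst⟩ a

theorem coords_v_mem_agentPast (i : Fin n) {s t : ℕ} (hs : s ≤ M.N) (hst : s ≤ t)
    (b : Fin (M.dy i)) : coords (P.v i s) b ∈ funSpan (primOn P (agentPast M.N i.succ t)) :=
  coords_prim_mem P (s := agentPast M.N i.succ t) (p := .v i ⟨s, Nat.lt_succ_of_le hs⟩)
    ⟨rfl, hst⟩ b

theorem funSpan_majorPrim_le_agentPast {t : ℕ} (ht : t ≤ M.N + 1) :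
    funSpan (majorPrim P t) ≤ funSpan (primOn P (agentPast M.N 0 t)) :=
  funSpan_le_iff.2 fun
    | .inl a => coords_init_mem_agentPast P 0 t a
    | .inr (s, a) =>
      coords_w_mem_agentPast P 0 (Nat.le_of_lt_succ (s.2.trans_le ht)) s.2 a

theorem coords_freeState_mem_agentPast (i : Fin n) {s t : ℕ} (hst : s ≤ t) (hs : s ≤ M.N + 1)
    (a : Fin (M.dx i.succ)) :
    coords (freeState P i s) a ∈ funSpan (primOn P (agentPast M.N i.succ t)) :=
  linearRecursion_mem (x := fun s => coords (freeState P i s))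
    (coords_init_mem_agentPast P i.succ t) (fun r _ => coords_freeState_succ P i r)
    (fun _ hr => coords_w_mem_agentPast P i.succ (Nat.le_of_lt_succ (hr.trans_le hs))
      (hr.trans_le hst)) a

theorem funSpan_minorPrim_le_agentPast (i : Fin n) {t : ℕ} (ht : t ≤ M.N) :
    funSpan (minorPrim P i t) ≤ funSpan (primOn P (agentPast M.N i.succ t)) := by
  refine funSpan_le_iff.2 fun (s, b) => ?_
  have hst : (s : ℕ) ≤ t := Nat.le_of_lt_succ s.2
  have hmem : coords (freeOutput P i s) b ∈ funSpan (primOn P (agentPast M.N i.succ t)) := by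
    rw [coords_freeOutput]
    exact add_mem (smulVec_mem _ (fun a => coords_freeState_mem_agentPast P i hst (by omega) a) b)
      (coords_v_mem_agentPast P i (hst.trans ht) hst b)
  exact hmem

end Primitives

variable [MeasurableSpace Ω] {P : Noise M Ω} {μ : Measure Ω}

section Orthogonality

theorem coordsL2_prim_mem {s : Set (Primitive n M.N)} {p : Primitive n M.N} (hp : p ∈ s)
    (a : Fin (M.primDim p)) : coordsL2 μ (P.prim p) a ∈ spanL2 μ (primOn P s) :=
  coordsL2_mem_spanL2 (primOn P s) ⟨⟨p, hp⟩, a⟩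

theorem coordsL2_W_mem {t : ℕ} (ht : t < M.N + 1) (j : Fin (n + 1)) (a : Fin (M.dx j)) :
    coordsL2 μ (P.W t) ⟨j, a⟩ ∈ spanL2 μ (primOn P {.w j ⟨t, ht⟩}) := by
  have hcoord : coords (P.W t) ⟨j, a⟩ = coords (P.prim (.w j ⟨t, ht⟩)) a := rfl
  rw [coordsL2, hcoord]
  exact coordsL2_prim_mem (Set.mem_singleton (Primitive.w j ⟨t, ht⟩)) a

theorem spanL2_primOn_mono {s s' : Set (Primitive n M.N)} (h : s ⊆ s') :
    spanL2 μ (primOn P s) ≤ spanL2 μ (primOn P s') :=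
  spanL2_le_iff.2 fun ⟨⟨_, hp⟩, a⟩ => coordsL2_prim_mem (h hp) a

/-- The space of square integrable random variables of mean zero. -/
abbrev meanZero (μ : Measure Ω) : Submodule ℝ (Lp ℝ 2 μ) := (ℝ ∙ toL2 μ 1)ᗮ

theorem toL2_mem_meanZero_iff [IsProbabilityMeasure μ] {f : Ω → ℝ} (hf : MemLp f 2 μ) :
    toL2 μ f ∈ meanZero μ ↔ ∫ ω, f ω ∂μ = 0 := by
  rw [Submodule.mem_orthogonal_singleton_iff_inner_right,
    inner_toL2 (f := 1) (memLp_const 1) hf]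
  simp

variable (hP : P.Admissible μ)
include hP

theorem funSpan_primOn_le_preimageL2 (s : Set (Primitive n M.N)) :
    funSpan (primOn P s) ≤ preimageL2 (spanL2 μ (primOn P s)) :=
  funSpan_le_preimageL2 fun k => hP.memLp_two k.1 k.2

theorem spanL2_primOn_le_meanZero [IsProbabilityMeasure μ] (s : Set (Primitive n M.N)) :
    spanL2 μ (primOn P s) ≤ meanZero μ :=
  spanL2_le_iff.2 fun k =>
    (toL2_mem_meanZero_iff (hP.memLp_two k.1 k.2)).2 (hP.mean_zero k.1 k.2)

theorem isOrtho_spanL2_primOn {s s' : Set (Primitive n M.N)} (h : Disjoint s s') :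
    spanL2 μ (primOn P s) ⟂ spanL2 μ (primOn P s') := by
  refine Submodule.isOrtho_span.2 ?_
  rintro _ ⟨⟨⟨p, hp⟩, a⟩, rfl⟩ _ ⟨⟨⟨q, hq⟩, b⟩, rfl⟩
  have hind : IndepFun (coords (P.prim p) a) (coords (P.prim q) b) μ :=
    (hP.indep.indepFun (h.ne_of_mem hp hq)).comp (measurable_pi_apply a) (measurable_pi_apply b)
  have hpL := hP.memLp_two p a
  have hqL := hP.memLp_two q b
  calc inner ℝ (toL2 μ (coords (P.prim p) a)) (toL2 μ (coords (P.prim q) b))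
      = ∫ ω, coords (P.prim p) a ω * coords (P.prim q) b ω ∂μ := inner_toL2 hpL hqL
    _ = (∫ ω, coords (P.prim p) a ω ∂μ) * ∫ ω, coords (P.prim q) b ω ∂μ :=
        hind.integral_fun_mul_eq_mul_integral hpL.aestronglyMeasurable hqL.aestronglyMeasurable
    _ = 0 := mul_eq_zero_of_left (hP.mean_zero p a) _

end Orthogonality

section ControlFreeSpaces

variable (P μ)

/-- The part of the information of the major agent that has mean zero: the classes of the linear
functions of the primitive random variables it has seen. -/
abbrev majorSpace (t : ℕ) : Submodule ℝ (Lp ℝ 2 μ) := spanL2 μ (majorPrim P t)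

/-- The classes of the affine functions of the primitive random variables that the major agent has
seen. -/
abbrev commonSpace (t : ℕ) : Submodule ℝ (Lp ℝ 2 μ) := spanL2 μ (withOne (majorPrim P t))

/-- The classes of the linear functions of the control-free outputs of a minor agent. -/
abbrev localSpace (i : Fin n) (t : ℕ) : Submodule ℝ (Lp ℝ 2 μ) := spanL2 μ (minorPrim P i t)

/-- The classes of the linear functions of all primitive random variables of an agent. -/
abbrev agentSpace (j : Fin (n + 1)) : Submodule ℝ (Lp ℝ 2 μ) :=
  spanL2 μ (primOn P (agentPast M.N j (M.N + 1)))

theorem majorSpace_mono : Monotone (majorSpace P μ) := fun _ t hst =>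
  spanL2_le_iff.2 fun
    | .inl a => coordsL2_mem_spanL2 (majorPrim P t) (.inl a)
    | .inr (r, a) => coordsL2_mem_spanL2 (majorPrim P t) (.inr (⟨r, r.2.trans_le hst⟩, a))

theorem commonSpace_mono : Monotone (commonSpace P μ) := fun _ _ hst => by
  simp only [commonSpace, spanL2_withOne]
  exact sup_le_sup_left (majorSpace_mono P μ hst) _

theorem localSpace_mono (i : Fin n) : Monotone (localSpace P μ i) := fun _ t hst =>
  spanL2_le_iff.2 fun (r, b) =>
    coordsL2_mem_spanL2 (minorPrim P i t) (⟨r, r.2.trans_le (Nat.succ_le_succ hst)⟩, b)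

theorem majorSpace_le_commonSpace (t : ℕ) : majorSpace P μ t ≤ commonSpace P μ t :=
  le_sup_right.trans (spanL2_withOne (majorPrim P t)).ge

variable {P μ} (hP : P.Admissible μ)
include hP

theorem majorSpace_le_agentPast {t : ℕ} (ht : t ≤ M.N + 1) :
    majorSpace P μ t ≤ spanL2 μ (primOn P (agentPast M.N 0 t)) :=
  spanL2_le_of_funSpan_le
    ((funSpan_majorPrim_le_agentPast P ht).trans (funSpan_primOn_le_preimageL2 hP _))

theorem localSpace_le_agentPast (i : Fin n) {t : ℕ} (ht : t ≤ M.N) :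
    localSpace P μ i t ≤ spanL2 μ (primOn P (agentPast M.N i.succ t)) :=
  spanL2_le_of_funSpan_le
    ((funSpan_minorPrim_le_agentPast P i ht).trans (funSpan_primOn_le_preimageL2 hP _))

theorem spanL2_primOn_le_orthogonal_commonSpace [IsProbabilityMeasure μ] {t : ℕ}
    (ht : t ≤ M.N + 1) {s : Set (Primitive n M.N)} (hs : Disjoint s (agentPast M.N 0 t)) :
    spanL2 μ (primOn P s) ≤ (commonSpace P μ t)ᗮ := by
  rw [← Submodule.isOrtho_iff_le, commonSpace, spanL2_withOne, Submodule.isOrtho_sup_right]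
  exact ⟨Submodule.isOrtho_iff_le.2 (spanL2_primOn_le_meanZero hP s),
    (isOrtho_spanL2_primOn hP hs).mono_right (majorSpace_le_agentPast hP ht)⟩

end ControlFreeSpaces

end Independence

section Information

theorem condExp_add_of_indep {Ω : Type*} {m m' mΩ : MeasurableSpace Ω} {μ : Measure Ω}
    (hm : m ≤ mΩ) (hm' : m' ≤ mΩ) [SigmaFinite (μ.trim hm)] (hind : Indep m' m μ) {f k : Ω → ℝ}
    (hf : StronglyMeasurable[m] f) (hk : StronglyMeasurable[m'] k) (hfi : Integrable f μ)
    (hki : Integrable k μ) : μ[f + k | m] =ᵐ[μ] fun ω => f ω + ∫ ω, k ω ∂μ := by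
  filter_upwards [condExp_add hfi hki m, condExp_indep_eq hm' hm hk hind] with ω hadd hindep
  rw [hadd, Pi.add_apply, condExp_of_stronglyMeasurable hm hf hfi, hindep]

/-- The space of measurable functions. -/
def measurableFunctions {Ω : Type*} (m : MeasurableSpace Ω) : Submodule ℝ (Ω → ℝ) where
  carrier := {f | Measurable[m] f}
  add_mem' hf hg := Measurable.add hf hg
  zero_mem' := measurable_const
  smul_mem' c _ hf := Measurable.const_smul hf c

variable {n : ℕ} {Ω : Type*} {M : Model n}

section Measurability

variable (P : Noise M Ω)

/-- The σ-algebra generated by the primitive random vectors whose labels belong to `s`. -/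
abbrev primSigma (s : Set (Primitive n M.N)) : MeasurableSpace Ω :=
  ⨆ p ∈ s, MeasurableSpace.comap (P.prim p) inferInstance

/-- The σ-algebra generated by the common information `I^c(t)`. -/
abbrev majorSigma (u : Control M Ω) (t : ℕ) : MeasurableSpace Ω :=
  MeasurableSpace.comap (majorInfo P u t) inferInstance

theorem funSpan_primOn_le_measurableFunctions (s : Set (Primitive n M.N)) :
    funSpan (primOn P s) ≤ measurableFunctions (primSigma P s) := by
  refine funSpan_le_iff.2 fun ⟨⟨p, hp⟩, a⟩ => ?_
  have hle : MeasurableSpace.comap (P.prim p) inferInstance ≤ primSigma P s :=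
    le_iSup₂_of_le p hp le_rfl
  exact (measurable_pi_apply a).comp ((comap_measurable (P.prim p)).mono hle le_rfl)

theorem majorSpan_le_measurableFunctions (u : Control M Ω) (t : ℕ) :
    majorSpan P t ≤ measurableFunctions (majorSigma P u t) := fun f hf => by
  obtain ⟨φ, hφ⟩ :=
    exists_affineMap_of_mem_funSpan_withOne (majorSpan_le_majorInfo P u t hf)
  rw [show f = φ ∘ majorInfo P u t from funext hφ]
  exact φ.continuous_of_finiteDimensional.measurable.comp (comap_measurable _)

variable {P}

theorem majorSigma_le_primSigma {u : Control M Ω} {t : ℕ} (hu : ∀ s < t, IsAdaptedAt P s (u s))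
    (ht : t ≤ M.N + 1) : majorSigma P u t ≤ primSigma P (agentPast M.N 0 t) := by
  have hle : majorSpan P t ≤ measurableFunctions (primSigma P (agentPast M.N 0 t)) :=
    funSpan_withOne_le measurable_const ((funSpan_majorPrim_le_agentPast P ht).trans
      (funSpan_primOn_le_measurableFunctions P _))
  have hmeas : Measurable[primSigma P (agentPast M.N 0 t)] (majorInfo P u t) :=
    (@measurable_pi_iff _ _ _ (primSigma P (agentPast M.N 0 t)) _ _).2 fun k =>
      hle (coords_majorInfo_mem hu k)
  exact hmeas.comap_le

end Measurability

variable [MeasurableSpace Ω] {P : Noise M Ω} {μ : Measure Ω} (hP : P.Admissible μ)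
include hP

section Membership

theorem localSpace_le_agentSpace (i : Fin n) {t : ℕ} (ht : t ≤ M.N) :
    localSpace P μ i t ≤ agentSpace P μ i.succ :=
  (localSpace_le_agentPast hP i ht).trans
    (spanL2_primOn_mono (agentPast_mono M.N i.succ (Nat.le_succ_of_le ht)))

theorem majorSpan_le_preimageL2 [IsProbabilityMeasure μ] {t : ℕ} (ht : t ≤ M.N + 1) :
    majorSpan P t ≤ preimageL2 (commonSpace P μ t) := by
  refine funSpan_le_preimageL2 fun
    | none => memLp_const 1
    | some k => ?_
  exact (funSpan_primOn_le_preimageL2 hP _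
    (funSpan_majorPrim_le_agentPast P ht (coords_mem_funSpan (majorPrim P t) k))).1

theorem funSpan_minorPrim_le_preimageL2 (i : Fin n) {t : ℕ} (ht : t ≤ M.N) :
    funSpan (minorPrim P i t) ≤ preimageL2 (localSpace P μ i t) :=
  funSpan_le_preimageL2 fun k => (funSpan_primOn_le_preimageL2 hP _
    (funSpan_minorPrim_le_agentPast P i ht (coords_mem_funSpan (minorPrim P i t) k))).1

theorem minorSpan_le_preimageL2 [IsProbabilityMeasure μ] (i : Fin n) {t : ℕ} (ht : t ≤ M.N) :
    minorSpan P i t ≤ preimageL2 (commonSpace P μ t ⊔ localSpace P μ i t) :=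
  sup_le ((majorSpan_le_preimageL2 hP (by omega)).trans (preimageL2_mono le_sup_left))
    ((funSpan_minorPrim_le_preimageL2 hP i ht).trans (preimageL2_mono le_sup_right))

/-- The information structure in `L²(μ)` that is given by the control-free information. -/
def informationStructure [IsProbabilityMeasure μ] : InformationStructure M (Lp ℝ 2 μ) where
  x₀ := coordsL2 μ P.x₁
  w t := coordsL2 μ (P.W t)
  common := commonSpace P μ
  loc := localSpace P μ
  agent i := agentSpace P μ i.succ
  hasOrthogonalProjection_common _ := inferInstance
  hasOrthogonalProjection_loc _ _ := inferInstance
  common_mono := commonSpace_mono P μ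
  loc_mono := localSpace_mono P μ
  loc_le_agent i _ ht := localSpace_le_agentSpace hP i ht.le
  agent_le_orthogonal_common i := spanL2_primOn_le_orthogonal_commonSpace hP M.N.le_succ
    (disjoint_agentPast (Fin.succ_ne_zero i) _ _)
  isOrtho_agent _ _ hij :=
    isOrtho_spanL2_primOn hP (disjoint_agentPast (fun h => hij (Fin.succ_injective n h)) _ _)
  x₀_major_mem a := majorSpace_le_commonSpace P μ 0 (coordsL2_mem_spanL2 (majorPrim P 0) (.inl a))
  x₀_minor_mem i a :=
    (funSpan_primOn_le_preimageL2 hP _ (coords_init_mem_agentPast P i.succ _ a)).2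
  w_major_mem t _ a := majorSpace_le_commonSpace P μ (t + 1)
    (coordsL2_mem_spanL2 (majorPrim P (t + 1)) (.inr (⟨t, t.lt_succ_self⟩, a)))
  w_major_mem_orthogonal _ ht a := spanL2_primOn_le_orthogonal_commonSpace hP
    (ht.le.trans M.N.le_succ)
    (disjoint_singleton_w_agentPast (ht.trans M.N.lt_succ_self) 0 0)
    (coordsL2_W_mem (ht.trans M.N.lt_succ_self) 0 a)
  w_minor_mem _ ht i a := (funSpan_primOn_le_preimageL2 hP _
    (coords_w_mem_agentPast P i.succ ht.le (ht.trans M.N.lt_succ_self) a)).2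
  w_minor_mem_orthogonal _ ht i a := Submodule.orthogonal_le (localSpace_le_agentPast hP i ht.le)
    (Submodule.isOrtho_iff_le.1 (isOrtho_spanL2_primOn hP
      (disjoint_singleton_w_agentPast (ht.trans M.N.lt_succ_self) i.succ i.succ))
      (coordsL2_W_mem (ht.trans M.N.lt_succ_self) i.succ a))

end Membership

section Conditioning

theorem primSigma_le (s : Set (Primitive n M.N)) : primSigma P s ≤ ‹MeasurableSpace Ω› :=
  iSup₂_le fun p _ => (hP.measurable p).comap_le

theorem indep_primSigma {s s' : Set (Primitive n M.N)} (h : Disjoint s s') :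
    Indep (primSigma P s) (primSigma P s') μ :=
  indep_iSup_of_disjoint (fun p => (hP.measurable p).comap_le) hP.indep.iIndep h

variable [IsProbabilityMeasure μ] {u : Control M Ω} {t : ℕ}

theorem condExp_majorSigma_add (hu : ∀ s < t, IsAdaptedAt P s (u s)) (ht : t ≤ M.N + 1)
    {s : Set (Primitive n M.N)} (hs : Disjoint s (agentPast M.N 0 t)) {f k : Ω → ℝ}
    (hf : f ∈ majorSpan P t) (hk : k ∈ funSpan (primOn P s)) :
    μ[f + k | majorSigma P u t] =ᵐ[μ] f := by
  have hle := majorSigma_le_primSigma hu ht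
  obtain ⟨hkL, hkmem⟩ := funSpan_primOn_le_preimageL2 hP s hk
  have hmean := (toL2_mem_meanZero_iff hkL).1 (spanL2_primOn_le_meanZero hP s hkmem)
  have hcond := condExp_add_of_indep (hle.trans (primSigma_le hP _)) (primSigma_le hP s)
    (indep_of_indep_of_le_right (indep_primSigma hP hs) hle)
    (majorSpan_le_measurableFunctions P u t hf).stronglyMeasurable
    (funSpan_primOn_le_measurableFunctions P s hk).stronglyMeasurable
    ((majorSpan_le_preimageL2 hP ht hf).1.integrable one_le_two) (hkL.integrable one_le_two)
  simpa only [hmean, add_zero] using hcond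

theorem toL2_condExp_majorSigma (hu : ∀ s < t, IsAdaptedAt P s (u s)) {T : ℕ} (htT : t ≤ T)
    (hT : T ≤ M.N + 1) {s : Set (Primitive n M.N)} (hs : Disjoint s (agentPast M.N 0 T))
    {x : Ω → ℝ} (hx : x ∈ majorSpan P t ⊔ funSpan (primOn P s)) :
    MemLp (μ[x | majorSigma P u t]) 2 μ ∧
      toL2 μ (μ[x | majorSigma P u t]) = (commonSpace P μ T).starProjection (toL2 μ x) := by
  obtain ⟨f, hf, k, hk, rfl⟩ := Submodule.mem_sup.1 hx
  have hst : Disjoint s (agentPast M.N 0 t) := hs.mono_right (agentPast_mono M.N 0 htT)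
  have hcond := condExp_majorSigma_add hP hu (htT.trans hT) hst hf hk
  obtain ⟨hfL, hfmem⟩ := majorSpan_le_preimageL2 hP (htT.trans hT) hf
  obtain ⟨hkL, hkmem⟩ := funSpan_primOn_le_preimageL2 hP s hk
  refine ⟨(memLp_congr_ae hcond).2 hfL, ?_⟩
  rw [toL2_congr_ae hcond, toL2_add hfL hkL]
  exact (starProjection_add_of_mem (commonSpace_mono P μ htT hfmem)
    (spanL2_primOn_le_orthogonal_commonSpace hP hT hs hkmem)).symm

end Conditioning

end Information

/-! ### Optimality in `L²` -/

section Trajectories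

section QuadraticForms

variable {Ω ι : Type*} [Fintype ι]

theorem dotProduct_mulVec_eq_sum (S : Matrix ι ι ℝ) (f : Ω → ι → ℝ) (ω : Ω) :
    f ω ⬝ᵥ S *ᵥ f ω = ∑ i, coords f i ω * (S •ᵥ coords f) i ω := by
  rw [← coords_mulVec]
  rfl

variable [MeasurableSpace Ω] {μ : Measure Ω}

theorem integrable_dotProduct_mulVec (S : Matrix ι ι ℝ) {f : Ω → ι → ℝ}
    (hf : ∀ k, MemLp (coords f k) 2 μ) : Integrable (fun ω => f ω ⬝ᵥ S *ᵥ f ω) μ := by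
  simp only [dotProduct_mulVec_eq_sum]
  exact integrable_finsetSum _ fun i _ => (hf i).integrable_mul (memLp_smulVec S hf i)

theorem integral_dotProduct_mulVec (S : Matrix ι ι ℝ) {f : Ω → ι → ℝ}
    (hf : ∀ k, MemLp (coords f k) 2 μ) :
    ∫ ω, f ω ⬝ᵥ S *ᵥ f ω ∂μ = quadForm S (coordsL2 μ f) := by
  simp only [dotProduct_mulVec_eq_sum]
  refine (integral_finsetSum _ fun i _ =>
    (hf i).integrable_mul (memLp_smulVec S hf i)).trans ?_
  refine Finset.sum_congr rfl fun i _ => ?_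
  exact (inner_toL2 (hf i) (memLp_smulVec S hf i)).symm.trans
    (congrArg (inner ℝ (coordsL2 μ f i)) (toL2_smulVec S hf i))

end QuadraticForms

variable {n : ℕ} {Ω : Type*} {M : Model n} [MeasurableSpace Ω] {P : Noise M Ω} {μ : Measure Ω}
  (hP : P.Admissible μ)
include hP

section Trajectory

variable {t : ℕ}

theorem memLp_coords_W (ht : t ≤ M.N) (p : Stacked M.dx) : MemLp (coords (P.W t) p) 2 μ :=
  hP.memLp_two (.w p.1 ⟨t, Nat.lt_succ_of_le ht⟩) p.2

variable [IsProbabilityMeasure μ]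

theorem isAdmissible_coordsL2 {v : Ω → Stacked M.du → ℝ} (hv : IsAdaptedAt P t v) (ht : t ≤ M.N) :
    (informationStructure hP).IsAdmissible t (coordsL2 μ v) where
  major_mem a := (majorSpan_le_preimageL2 hP (ht.trans M.N.le_succ) (hv.major_mem a)).2
  minor_mem i a := (minorSpan_le_preimageL2 hP i ht (hv.minor_mem i a)).2

theorem memLp_coords_of_isAdaptedAt {v : Ω → Stacked M.du → ℝ} (hv : IsAdaptedAt P t v)
    (ht : t ≤ M.N) : ∀ p, MemLp (coords v p) 2 μ :=
  forall_stacked.2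
    ⟨fun a => (majorSpan_le_preimageL2 hP (ht.trans M.N.le_succ) (hv.major_mem a)).1,
      fun i a => (minorSpan_le_preimageL2 hP i ht (hv.minor_mem i a)).1⟩

variable {u : Control M Ω}

theorem memLp_coords_state (hu : ∀ s < t, IsAdaptedAt P s (u s)) (ht : t ≤ M.N + 1)
    (p : Stacked M.dx) : MemLp (coords (state P u t) p) 2 μ := by
  have hcontrol : ∀ s < t, ∀ q, coords (u s) q ∈ preimageL2 (⊤ : Submodule ℝ (Lp ℝ 2 μ)) :=
    fun s hs q => ⟨memLp_coords_of_isAdaptedAt hP (hu s hs) (by omega) q, trivial⟩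
  have hnoise : ∀ s < t, ∀ q, coords (P.W s) q ∈ preimageL2 (⊤ : Submodule ℝ (Lp ℝ 2 μ)) :=
    fun s hs q => ⟨memLp_coords_W hP (by omega) q, trivial⟩
  exact (linearRecursion_mem (K := preimageL2 ⊤) (x := fun s => coords (state P u s))
    (fun q => ⟨hP.memLp_two (.init q.1) q.2, trivial⟩)
    (fun s _ => (coords_state_succ P u s).trans (add_assoc _ _ _))
    (fun s hs q => add_mem (smulVec_mem M.B (hcontrol s hs) q) (hnoise s hs q)) p).1

theorem isTrajectory_coordsL2 (hu : ∀ t < M.N, IsAdaptedAt P t (u t)) :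
    (informationStructure hP).IsTrajectory (fun t => coordsL2 μ (state P u t))
      (fun t => coordsL2 μ (u t)) where
  init := rfl
  step t ht := by
    have hx := memLp_coords_state hP (fun s hs => hu s (hs.trans ht)) (ht.le.trans M.N.le_succ)
    have hv := memLp_coords_of_isAdaptedAt hP (hu t ht) ht.le
    have hAx : ∀ p, MemLp (coords (fun ω => M.A *ᵥ state P u t ω) p) 2 μ :=
      coords_mulVec M.A (state P u t) ▸ memLp_smulVec M.A hx
    have hBu : ∀ p, MemLp (coords (fun ω => M.B *ᵥ u t ω) p) 2 μ :=
      coords_mulVec M.B (u t) ▸ memLp_smulVec M.B hv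
    rw [← coordsL2_mulVec M.A hx, ← coordsL2_mulVec M.B hv, ← coordsL2_add hAx hBu]
    exact coordsL2_add (fun p => (hAx p).add (hBu p)) (memLp_coords_W hP ht.le)
  admissible t ht := isAdmissible_coordsL2 hP (hu t ht) ht.le

theorem integrable_stageCost (hu : ∀ t < M.N, IsAdaptedAt P t (u t)) (ht : t < M.N) :
    Integrable (fun ω => state P u t ω ⬝ᵥ M.Q *ᵥ state P u t ω + u t ω ⬝ᵥ M.R *ᵥ u t ω) μ :=
  (integrable_dotProduct_mulVec M.Q (memLp_coords_state hP (fun s hs => hu s (hs.trans ht))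
    (ht.le.trans M.N.le_succ))).add
    (integrable_dotProduct_mulVec M.R (memLp_coords_of_isAdaptedAt hP (hu t ht) ht.le))

theorem integrable_terminalCost (hu : ∀ t < M.N, IsAdaptedAt P t (u t)) :
    Integrable (fun ω => state P u M.N ω ⬝ᵥ M.QT *ᵥ state P u M.N ω) μ :=
  integrable_dotProduct_mulVec M.QT (memLp_coords_state hP hu M.N.le_succ)

theorem integrable_pathCost (hu : ∀ t < M.N, IsAdaptedAt P t (u t)) :
    Integrable (pathCost P u) μ :=
  (integrable_finsetSum _ fun _ ht => integrable_stageCost hP hu (Finset.mem_range.1 ht)).add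
    (integrable_terminalCost hP hu)

theorem integral_pathCost (hu : ∀ t < M.N, IsAdaptedAt P t (u t)) :
    ∫ ω, pathCost P u ω ∂μ = M.commonRegulator.cost (fun t => coordsL2 μ (state P u t))
      (fun t => coordsL2 μ (u t)) := by
  have hstage := fun t ht => integrable_stageCost hP hu (t := t) (Finset.mem_range.1 ht)
  simp only [pathCost]
  rw [integral_add (integrable_finsetSum _ hstage) (integrable_terminalCost hP hu),
    integral_finsetSum _ hstage,
    integral_dotProduct_mulVec M.QT (memLp_coords_state hP hu M.N.le_succ)]
  refine congrArg (· + _) (Finset.sum_congr rfl fun t ht => ?_)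
  have htN := Finset.mem_range.1 ht
  have hx := memLp_coords_state hP (fun s hs => hu s (hs.trans htN)) (htN.le.trans M.N.le_succ)
  have hv := memLp_coords_of_isAdaptedAt hP (hu t htN) htN.le
  rw [integral_add (integrable_dotProduct_mulVec M.Q hx) (integrable_dotProduct_mulVec M.R hv),
    integral_dotProduct_mulVec M.Q hx, integral_dotProduct_mulVec M.R hv]
  rfl

end Trajectory

section Optimality

variable [IsProbabilityMeasure μ]

theorem exists_mem_majorSpan_toL2_eq {t : ℕ} (ht : t ≤ M.N + 1) {x : Lp ℝ 2 μ}
    (hx : x ∈ commonSpace P μ t) : ∃ f ∈ majorSpan P t, toL2 μ f = x :=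
  exists_mem_funSpan_toL2_eq
    (fun k => (majorSpan_le_preimageL2 hP ht (coords_mem_funSpan _ k)).1) hx

theorem exists_mem_minorSpan_toL2_eq (i : Fin n) {t : ℕ} (ht : t ≤ M.N) {x : Lp ℝ 2 μ}
    (hx : x ∈ commonSpace P μ t ⊔ localSpace P μ i t) : ∃ f ∈ minorSpan P i t, toL2 μ f = x := by
  obtain ⟨y, hy, z, hz, rfl⟩ := Submodule.mem_sup.1 hx
  obtain ⟨f, hf, rfl⟩ := exists_mem_majorSpan_toL2_eq hP (ht.trans M.N.le_succ) hy
  obtain ⟨k, hk, rfl⟩ := exists_mem_funSpan_toL2_eq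
    (fun k => (funSpan_minorPrim_le_preimageL2 hP i ht (coords_mem_funSpan _ k)).1) hz
  exact ⟨f + k, Submodule.add_mem_sup hf hk,
    toL2_add (majorSpan_le_preimageL2 hP (ht.trans M.N.le_succ) hf).1
      (funSpan_minorPrim_le_preimageL2 hP i ht hk).1⟩

theorem exists_isAdaptedAt_coordsL2_eq {t : ℕ} (ht : t ≤ M.N) {v : Stacked M.du → Lp ℝ 2 μ}
    (hv : (informationStructure hP).IsAdmissible t v) :
    ∃ f : Ω → Stacked M.du → ℝ, IsAdaptedAt P t f ∧ coordsL2 μ f = v := by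
  choose f hf hfv using fun a =>
    exists_mem_majorSpan_toL2_eq hP (ht.trans M.N.le_succ) (hv.major_mem a)
  choose k hk hkv using fun i a => exists_mem_minorSpan_toL2_eq hP i ht (hv.minor_mem i a)
  refine ⟨fun ω p => Fin.cases (motive := fun j => Fin (M.du j) → ℝ) (fun a => f a ω)
    (fun i a => k i a ω) p.1 p.2, ⟨hf, hk⟩, funext (forall_stacked.2 ⟨hfv, hkv⟩)⟩

theorem exists_control_coordsL2_eq_optimalControl : ∃ g : AffineStrategy M, ∀ t < M.N,
    coordsL2 μ (g.control P t) = (informationStructure hP).optimalControl t := by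
  have hexists : ∀ t, ∃ f, IsAdaptedAt P t f ∧
      (t < M.N → coordsL2 μ f = (informationStructure hP).optimalControl t) := fun t => by
    by_cases ht : t < M.N
    · obtain ⟨f, hf, hft⟩ := exists_isAdaptedAt_coordsL2_eq hP ht.le
        ((informationStructure hP).isTrajectory_optimal.admissible t ht)
      exact ⟨f, hf, fun _ => hft⟩
    · exact ⟨0, ⟨fun _ => zero_mem _, fun _ _ => zero_mem _⟩, fun h => absurd h ht⟩
  choose u hu hopt using hexists
  obtain ⟨g, rfl⟩ := exists_control_eq P u hu
  exact ⟨g, hopt⟩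

/-- The class of the control at time `t` is the certainty equivalent feedback to the current
state. -/
def IsFeedbackAt (u : Control M Ω) (t : ℕ) : Prop :=
  coordsL2 μ (u t) = (informationStructure hP).feedback t (coordsL2 μ (state P u t))

/-- The affine strategy generates the certainty equivalent feedback controls. -/
def IsFeedback (g : AffineStrategy M) : Prop :=
  ∀ t < M.N, IsFeedbackAt hP (g.control P) t

variable (g : AffineStrategy M)

theorem isTrajectory_control : (informationStructure hP).IsTrajectory
    (fun t => coordsL2 μ (state P (g.control P) t)) (fun t => coordsL2 μ (g.control P t)) :=
  isTrajectory_coordsL2 hP fun t _ => g.isAdaptedAt_control P t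

theorem isFeedback_iff : IsFeedback hP g ↔
    ∀ t < M.N, coordsL2 μ (g.control P t) = (informationStructure hP).optimalControl t :=
  (isTrajectory_control hP g).forall_eq_feedback_iff

theorem cost_eq : g.cost P μ = M.commonRegulator.cost
    (fun t => coordsL2 μ (state P (g.control P) t)) (fun t => coordsL2 μ (g.control P t)) :=
  integral_pathCost hP fun t _ => g.isAdaptedAt_control P t

theorem cost_le_optimal_iff : g.cost P μ ≤ M.commonRegulator.cost
    (informationStructure hP).optimalState (informationStructure hP).optimalControl ↔
      IsFeedback hP g := by
  rw [cost_eq hP]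
  exact (isTrajectory_control hP g).cost_le_optimal_iff

theorem exists_isFeedback : ∃ g : AffineStrategy M, IsFeedback hP g := by
  obtain ⟨g, hg⟩ := exists_control_coordsL2_eq_optimalControl hP
  exact ⟨g, (isFeedback_iff hP g).2 hg⟩

theorem isOptimal_iff_isFeedback : g.IsOptimal P μ ↔ IsFeedback hP g := by
  constructor
  · intro hg
    obtain ⟨g', hg'⟩ := exists_isFeedback hP
    exact (cost_le_optimal_iff hP g).1 ((hg g').trans ((cost_le_optimal_iff hP g').2 hg'))
  · intro hg g'
    refine ((cost_le_optimal_iff hP g).2 hg).trans ?_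
    rw [cost_eq hP]
    exact (isTrajectory_control hP g').optimal_cost_le

variable {g}

theorem ae_control_eq_of_isFeedback {g' : AffineStrategy M} (hg : IsFeedback hP g)
    (hg' : IsFeedback hP g') {t : ℕ} (ht : t < M.N) :
    ∀ᵐ ω ∂μ, g.control P t ω = g'.control P t ω :=
  (ae_eq_iff_coordsL2_eq
    (memLp_coords_of_isAdaptedAt hP (g.isAdaptedAt_control P t) ht.le)
    (memLp_coords_of_isAdaptedAt hP (g'.isAdaptedAt_control P t) ht.le)).2
    (((isFeedback_iff hP g).1 hg t ht).trans ((isFeedback_iff hP g').1 hg' t ht).symm)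

end Optimality

end Trajectories

/-! ### Linear least mean square estimates -/

section CommonAndLocalParts

variable {n : ℕ} {Ω : Type*} {M : Model n} [MeasurableSpace Ω] {P : Noise M Ω} {μ : Measure Ω}
  {u : Control M Ω} {t : ℕ}

section Splitting

variable (P μ u)

theorem coords_commonState_succ (t : ℕ) :
    coords (commonState P μ u (t + 1)) =
      M.A •ᵥ coords (commonState P μ u t) + M.B •ᵥ coords (commonControl P μ u t) := by
  rw [← coords_mulVec, ← coords_mulVec]
  rfl

theorem coords_localState_succ (t : ℕ) :
    coords (localState P μ u (t + 1)) =
      M.A •ᵥ coords (localState P μ u t) + M.B •ᵥ coords (localControl P μ u t) := by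
  rw [← coords_mulVec, ← coords_mulVec]
  rfl

theorem state_eq_add (t : ℕ) :
    state P u t = commonState P μ u t + localState P μ u t + stochState P t := by
  induction t with
  | zero => exact funext fun ω => ((congrArg (· + P.x₁ ω) (add_zero 0)).trans (zero_add _)).symm
  | succ t ih =>
    funext ω
    simp only [state, commonState, localState, stochState, localControl, ih, Pi.add_apply,
      mulVec_add, mulVec_sub]
    abel

theorem coords_zc (t : ℕ) (p : Stacked M.dx) :
    coords (zc P μ u t) p = coords (state P u t) p - coords (localState P μ u t) p := by
  rw [state_eq_add P μ u]
  funext ω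
  exact (add_sub_cancel_right _ _).symm.trans (congrArg (· - _) (add_right_comm _ _ _))

theorem coords_zl (i : Fin n) (t : ℕ) (a : Fin (M.dx i.succ)) :
    coords (zl P μ u i t) a =
      coords (state P u t) ⟨i.succ, a⟩ - coords (commonState P μ u t) ⟨i.succ, a⟩ := by
  rw [state_eq_add P μ u]
  funext ω
  exact (add_sub_cancel_left _ _).symm.trans (congrArg (· - _) (add_assoc _ _ _).symm)

variable {P μ u} [IsProbabilityMeasure μ] (hP : P.Admissible μ)
  (hu : ∀ s < M.N, IsAdaptedAt P s (u s))
include hP hu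

theorem coordsL2_commonControl (ht : t < M.N) (p : Stacked M.du) :
    MemLp (coords (commonControl P μ u t) p) 2 μ ∧ coordsL2 μ (commonControl P μ u t) p =
      (informationStructure hP).commonPart (coordsL2 μ (u t)) p := by
  have hpast : ∀ s < t, IsAdaptedAt P s (u s) := fun s hs => hu s (hs.trans ht)
  revert p
  exact forall_stacked.2
    ⟨fun a => toL2_condExp_majorSigma hP hpast ht.le M.N.le_succ (Set.empty_disjoint _)
        (Submodule.mem_sup_left ((hu t ht).major_mem a)),
      fun i a => toL2_condExp_majorSigma hP hpast ht.le M.N.le_succ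
        (disjoint_agentPast (Fin.succ_ne_zero i) t M.N)
        (sup_le_sup_left (funSpan_minorPrim_le_agentPast P i ht.le) _
          ((hu t ht).minor_mem i a))⟩

theorem coordsL2_localControl (ht : t < M.N) (p : Stacked M.du) :
    MemLp (coords (localControl P μ u t) p) 2 μ ∧ coordsL2 μ (localControl P μ u t) p =
      coordsL2 μ (u t) p - (informationStructure hP).commonPart (coordsL2 μ (u t)) p := by
  have hv := memLp_coords_of_isAdaptedAt hP (hu t ht) ht.le p
  obtain ⟨hc, hcommon⟩ := coordsL2_commonControl hP hu ht p
  exact ⟨hv.sub hc, (toL2_sub hv hc).trans (congrArg (coordsL2 μ (u t) p - ·) hcommon)⟩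

theorem coords_commonState_mem (ht : t ≤ M.N) (p : Stacked M.dx) :
    coords (commonState P μ u t) p ∈ preimageL2 (commonSpace P μ M.N) := by
  refine linearRecursion_mem (x := fun s => coords (commonState P μ u s)) (fun _ => zero_mem _)
    (fun s _ => coords_commonState_succ P μ u s) (fun s hs => smulVec_mem _ fun q => ?_) p
  obtain ⟨hc, hcommon⟩ := coordsL2_commonControl hP hu (hs.trans_le ht) q
  refine ⟨hc, ?_⟩
  rw [coordsL2] at hcommon
  exact hcommon ▸ Submodule.starProjection_apply_mem _ _

theorem coords_localState_mem (ht : t ≤ M.N) (p : Stacked M.dx) :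
    coords (localState P μ u t) p ∈ preimageL2 (commonSpace P μ M.N)ᗮ := by
  refine linearRecursion_mem (x := fun s => coords (localState P μ u s)) (fun _ => zero_mem _)
    (fun s _ => coords_localState_succ P μ u s) (fun s hs => smulVec_mem _ fun q => ?_) p
  obtain ⟨hl, hlocal⟩ := coordsL2_localControl hP hu (hs.trans_le ht) q
  refine ⟨hl, ?_⟩
  rw [coordsL2] at hlocal
  exact hlocal ▸ Submodule.sub_starProjection_mem_orthogonal _

theorem coordsL2_state_sub_zc_mem (ht : t ≤ M.N) (p : Stacked M.dx) :
    coordsL2 μ (state P u t) p - coordsL2 μ (zc P μ u t) p ∈ (commonSpace P μ M.N)ᗮ := by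
  obtain ⟨hl, hmem⟩ := coords_localState_mem hP hu ht p
  have hx := memLp_coords_state hP (fun s hs => hu s (hs.trans_le ht)) (ht.trans M.N.le_succ) p
  rwa [coordsL2, coordsL2, coords_zc, toL2_sub hx hl, sub_sub_cancel]

theorem coordsL2_state_sub_zl_mem (ht : t ≤ M.N) (i : Fin n) (a : Fin (M.dx i.succ)) :
    coordsL2 μ (state P u t) ⟨i.succ, a⟩ - coordsL2 μ (zl P μ u i t) a ∈
      commonSpace P μ M.N := by
  obtain ⟨hc, hmem⟩ := coords_commonState_mem hP hu ht ⟨i.succ, a⟩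
  have hx := memLp_coords_state hP (fun s hs => hu s (hs.trans_le ht)) (ht.trans M.N.le_succ)
    ⟨i.succ, a⟩
  rwa [coordsL2, coordsL2, coords_zl, toL2_sub hx hc, sub_sub_cancel]

end Splitting

section ControlFreeIdentities

variable [IsProbabilityMeasure μ] (hP : P.Admissible μ)
  (hu : ∀ s < t, IsAdaptedAt P s (u s)) (ht : t ≤ M.N)
include hP hu ht

theorem coordsL2_majorInfo_mem (k : M.MajorIdx t) :
    MemLp (coords (majorInfo P u t) k) 2 μ ∧
      coordsL2 μ (majorInfo P u t) k ∈ commonSpace P μ t :=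
  majorSpan_le_preimageL2 hP (ht.trans M.N.le_succ) (coords_majorInfo_mem hu k)

theorem coordsL2_minorInfo_mem (i : Fin n) (k : M.MinorIdx i t) :
    MemLp (coords (minorInfo P u i t) k) 2 μ ∧
      coordsL2 μ (minorInfo P u i t) k ∈ commonSpace P μ t ⊔ localSpace P μ i t :=
  minorSpan_le_preimageL2 hP i ht (coords_minorInfo_mem hu i k)

theorem commonSpace_eq_sup_H0 : commonSpace P μ t = (ℝ ∙ toL2 μ 1) ⊔ H0 μ P u t := by
  have hprim : majorSpace P μ t ≤ H0 μ P u t := spanL2_le_of_funSpan_le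
    ((funSpan_majorPrim_le_majorInfo P u t).trans (funSpan_le_preimageL2 fun k =>
      (coordsL2_majorInfo_mem hP hu ht k).1))
  have hinfo : H0 μ P u t ≤ commonSpace P μ t :=
    spanL2_le_iff.2 fun k => (coordsL2_majorInfo_mem hP hu ht k).2
  have hone : commonSpace P μ t = (ℝ ∙ toL2 μ 1) ⊔ majorSpace P μ t := spanL2_withOne _
  exact le_antisymm (hone.trans_le (sup_le_sup_left hprim _))
    (sup_le (le_sup_left.trans hone.ge) hinfo)

theorem commonSpace_sup_localSpace_eq_sup_Hi (i : Fin n) :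
    commonSpace P μ t ⊔ localSpace P μ i t = (ℝ ∙ toL2 μ 1) ⊔ Hi μ P u i t := by
  have hprim : localSpace P μ i t ≤ Hi μ P u i t := spanL2_le_of_funSpan_le
    ((funSpan_minorPrim_le_minorInfo P u i t).trans (funSpan_le_preimageL2 fun k =>
      (coordsL2_minorInfo_mem hP hu ht i k).1))
  have hinfo : Hi μ P u i t ≤ commonSpace P μ t ⊔ localSpace P μ i t :=
    spanL2_le_iff.2 fun k => (coordsL2_minorInfo_mem hP hu ht i k).2
  have hcommon := commonSpace_eq_sup_H0 hP hu ht
  refine le_antisymm (sup_le ?_ (hprim.trans le_sup_right)) (sup_le ?_ hinfo)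
  · exact hcommon.trans_le (sup_le_sup_left (H0_le_Hi μ P u i t) _)
  · exact le_sup_left.trans (hcommon.ge.trans le_sup_left)

end ControlFreeIdentities

end CommonAndLocalParts

section LinearEstimates

variable {n : ℕ} {Ω : Type*} {M : Model n} [MeasurableSpace Ω]

section EstimateClasses

variable (P : Noise M Ω) (μ : Measure Ω) (u : Control M Ω)

theorem memLp_coords_zcHat (t : ℕ) (p : Stacked M.dx) : MemLp (coords (zcHat μ P u t) p) 2 μ :=
  Lp.memLp _

theorem memLp_coords_zlHat (i : Fin n) (t : ℕ) (a : Fin (M.dx i.succ)) :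
    MemLp (coords (zlHat μ P u i t) a) 2 μ :=
  (Lp.memLp _).sub (Lp.memLp _)

theorem coordsL2_zcHat (t : ℕ) (p : Stacked M.dx) : coordsL2 μ (zcHat μ P u t) p =
    (H0 μ P u t).starProjection (coordsL2 μ (zc P μ u t) p) :=
  toL2_coeFn _

theorem coordsL2_zlHat (i : Fin n) (t : ℕ) (a : Fin (M.dx i.succ)) :
    coordsL2 μ (zlHat μ P u i t) a =
      (Htilde μ P u i t).starProjection (coordsL2 μ (zl P μ u i t) a) :=
  (toL2_congr_ae (zlHat_ae_eq μ P u i t a)).trans (toL2_coeFn _)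

end EstimateClasses

variable {P : Noise M Ω} {μ : Measure Ω}
  [IsProbabilityMeasure μ] (hP : P.Admissible μ) {u : Control M Ω} {t : ℕ}

section GainForm

variable (hu : ∀ s < M.N, IsAdaptedAt P s (u s))
include hu

theorem coords_state_mem_meanZero (ht : t ≤ M.N) (hfb : ∀ s < t, IsFeedbackAt hP u s)
    (p : Stacked M.dx) : coords (state P u t) p ∈ preimageL2 (meanZero μ) := by
  refine ⟨memLp_coords_state hP (fun s hs => hu s (hs.trans_le ht)) (ht.trans M.N.le_succ) p, ?_⟩
  exact (isTrajectory_coordsL2 hP hu).state_mem_orthogonal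
    (le_sup_left.trans (spanL2_withOne (majorPrim P 0)).ge)
    (fun q => spanL2_primOn_le_meanZero hP _
      (coordsL2_prim_mem (Set.mem_singleton (Primitive.init q.1)) q.2))
    (fun _ hs q => spanL2_primOn_le_meanZero hP _
      (coordsL2_W_mem (hs.trans M.N.lt_succ_self) q.1 q.2)) ht hfb p

theorem coords_control_mem_meanZero (ht : t < M.N) (hfb : ∀ s ≤ t, IsFeedbackAt hP u s)
    (p : Stacked M.du) : coords (u t) p ∈ preimageL2 (meanZero μ) := by
  refine ⟨memLp_coords_of_isAdaptedAt hP (hu t ht) ht.le p, ?_⟩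
  change coordsL2 μ (u t) p ∈ meanZero μ
  rw [hfb t le_rfl]
  exact (informationStructure hP).feedback_mem_orthogonal ht
    (le_sup_left.trans (spanL2_withOne (majorPrim P t)).ge)
    (fun q => (coords_state_mem_meanZero hP hu ht.le (fun s hs => hfb s hs.le) q).2) p

theorem coords_output_mem_meanZero (ht : t ≤ M.N) (hfb : ∀ s < t, IsFeedbackAt hP u s)
    (i : Fin n) (b : Fin (M.dy i)) :
    coords (output P u i t) b ∈ preimageL2 (meanZero μ) := by
  rw [coords_output_eq_state]
  have hv := funSpan_primOn_le_preimageL2 hP _ (coords_v_mem_agentPast P i ht le_rfl b)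
  exact add_mem
    (smulVec_mem _ (fun a => coords_state_mem_meanZero hP hu ht hfb ⟨i.succ, a⟩) b)
    ⟨hv.1, spanL2_primOn_le_meanZero hP _ hv.2⟩

theorem H0_le_meanZero (ht : t ≤ M.N) (hfb : ∀ s < t, IsFeedbackAt hP u s) :
    H0 μ P u t ≤ meanZero μ := by
  refine spanL2_le_iff.2 ?_
  rintro (⟨s, a⟩ | ⟨s, a⟩)
  · have hst : (s : ℕ) ≤ t := Nat.le_of_lt_succ s.2
    exact (coords_state_mem_meanZero hP hu (hst.trans ht)
      (fun r hr => hfb r (hr.trans_le hst)) ⟨0, a⟩).2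
  · exact (coords_control_mem_meanZero hP hu (s.2.trans_le ht)
      (fun r hr => hfb r (hr.trans_lt s.2)) ⟨0, a⟩).2

theorem Hi_le_meanZero (ht : t ≤ M.N) (hfb : ∀ s < t, IsFeedbackAt hP u s) (i : Fin n) :
    Hi μ P u i t ≤ meanZero μ := by
  refine spanL2_le_iff.2 ?_
  rintro (k | ⟨s, b⟩ | ⟨s, a⟩)
  · exact H0_le_meanZero hP hu ht hfb (coordsL2_mem_spanL2 (majorInfo P u t) k)
  · have hst : (s : ℕ) ≤ t := Nat.le_of_lt_succ s.2
    exact (coords_output_mem_meanZero hP hu (hst.trans ht)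
      (fun r hr => hfb r (hr.trans_le hst)) i b).2
  · exact (coords_control_mem_meanZero hP hu (s.2.trans_le ht)
      (fun r hr => hfb r (hr.trans_lt s.2)) ⟨i.succ, a⟩).2

theorem Htilde_eq_localSpace (ht : t < M.N) (hfb : ∀ s < t, IsFeedbackAt hP u s) (i : Fin n) :
    Htilde μ P u i t = localSpace P μ i t := by
  have hpast : ∀ s < t, IsAdaptedAt P s (u s) := fun s hs => hu s (hs.trans ht)
  have hloc : localSpace P μ i t ≤ (commonSpace P μ t)ᗮ :=
    ((informationStructure hP).loc_le_orthogonal_common i ht).trans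
      (Submodule.orthogonal_le (commonSpace_mono P μ ht.le))
  calc (H0 μ P u t)ᗮ ⊓ Hi μ P u i t
      = (H0 μ P u t)ᗮ ⊓ (meanZero μ ⊓ ((ℝ ∙ toL2 μ 1) ⊔ Hi μ P u i t)) := by
        rw [orthogonal_inf_sup_eq (Hi_le_meanZero hP hu ht.le hfb i)]
    _ = (commonSpace P μ t)ᗮ ⊓ (commonSpace P μ t ⊔ localSpace P μ i t) := by
        rw [commonSpace_sup_localSpace_eq_sup_Hi hP hpast ht.le i,
          commonSpace_eq_sup_H0 hP hpast ht.le, ← Submodule.inf_orthogonal, ← inf_assoc,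
          inf_comm (H0 μ P u t)ᗮ]
    _ = localSpace P μ i t := orthogonal_inf_sup_eq hloc

theorem coordsL2_zcHat_eq (ht : t < M.N) (hfb : ∀ s < t, IsFeedbackAt hP u s) (p : Stacked M.dx) :
    coordsL2 μ (zcHat μ P u t) p =
      (commonSpace P μ t).starProjection (coordsL2 μ (state P u t) p) := by
  have hsup := commonSpace_eq_sup_H0 hP (fun s hs => hu s (hs.trans ht)) ht.le
  have hle : H0 μ P u t ≤ commonSpace P μ M.N :=
    (le_sup_right.trans hsup.ge).trans (commonSpace_mono P μ ht.le)
  rw [coordsL2_zcHat, ← starProjection_congr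
    (Submodule.orthogonal_le hle (coordsL2_state_sub_zc_mem hP hu ht.le p))]
  exact (starProjection_eq_of_eq_sup hsup (H0_le_meanZero hP hu ht.le hfb)
    (coords_state_mem_meanZero hP hu ht.le hfb p).2).symm

theorem coordsL2_zlHat_eq (ht : t < M.N) (hfb : ∀ s < t, IsFeedbackAt hP u s) (i : Fin n)
    (a : Fin (M.dx i.succ)) : coordsL2 μ (zlHat μ P u i t) a =
      (localSpace P μ i t).starProjection (coordsL2 μ (state P u t) ⟨i.succ, a⟩) := by
  have hle : commonSpace P μ M.N ≤ (localSpace P μ i t)ᗮ := Submodule.isOrtho_iff_le.1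
    (Submodule.isOrtho_iff_le.2 ((informationStructure hP).loc_le_orthogonal_common i ht)).symm
  rw [starProjection_congr (hle (coordsL2_state_sub_zl_mem hP hu ht.le i a)), coordsL2_zlHat]
  simp only [Htilde_eq_localSpace hP hu ht hfb i]

theorem commonControl_ae_eq_iff (ht : t < M.N) (hfb : ∀ s < t, IsFeedbackAt hP u s) :
    (∀ᵐ ω ∂μ, commonControl P μ u t ω = -(M.Lc t *ᵥ zcHat μ P u t ω)) ↔
      (informationStructure hP).commonPart (coordsL2 μ (u t)) = -(M.Lc t •ᵥ fun p =>
        (commonSpace P μ t).starProjection (coordsL2 μ (state P u t) p)) := by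
  rw [ae_eq_neg_mulVec_iff (M.Lc t) (fun p => (coordsL2_commonControl hP hu ht p).1)
    (memLp_coords_zcHat P μ u t), funext fun p => (coordsL2_commonControl hP hu ht p).2,
    funext fun p => coordsL2_zcHat_eq hP hu ht hfb p]

theorem localControl_ae_eq_iff (ht : t < M.N) (hfb : ∀ s < t, IsFeedbackAt hP u s) (i : Fin n) :
    (∀ᵐ ω ∂μ, (fun a => localControl P μ u t ω ⟨i.succ, a⟩) =
        -(M.Ll i t *ᵥ zlHat μ P u i t ω)) ↔
      (informationStructure hP).localPart (coordsL2 μ (u t)) i = -(M.Ll i t •ᵥ fun a =>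
        (localSpace P μ i t).starProjection (coordsL2 μ (state P u t) ⟨i.succ, a⟩)) := by
  have hlocal := fun a => coordsL2_localControl hP hu ht ⟨i.succ, a⟩
  refine (ae_eq_neg_mulVec_iff (M.Ll i t) (fun a => (hlocal a).1)
    (memLp_coords_zlHat P μ u i t)).trans (Eq.congr ?_ ?_)
  · exact funext fun a => (hlocal a).2
  · rw [funext fun a => coordsL2_zlHat_eq hP hu ht hfb i a]

theorem gainForm_iff_isFeedbackAt (ht : t < M.N) (hfb : ∀ s < t, IsFeedbackAt hP u s) :
    ((∀ᵐ ω ∂μ, commonControl P μ u t ω = -(M.Lc t *ᵥ zcHat μ P u t ω)) ∧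
      ∀ i : Fin n, ∀ᵐ ω ∂μ, (fun a => localControl P μ u t ω ⟨i.succ, a⟩) =
        -(M.Ll i t *ᵥ zlHat μ P u i t ω)) ↔ IsFeedbackAt hP u t := by
  simp only [commonControl_ae_eq_iff hP hu ht hfb, localControl_ae_eq_iff hP hu ht hfb]
  exact ((isAdmissible_coordsL2 hP (hu t ht) ht.le).eq_feedback_iff ht _).symm

end GainForm

theorem hasGainForm_iff_isFeedback (g : AffineStrategy M) :
    g.HasGainForm P μ ↔ IsFeedback hP g := by
  have hgain := fun {t} => gainForm_iff_isFeedbackAt hP (t := t)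
    fun s _ => g.isAdaptedAt_control P s
  constructor
  · intro h t
    induction t using Nat.strong_induction_on with
    | _ t ih => exact fun ht => (hgain ht fun s hs => ih s hs (hs.trans ht)).1 (h t ht)
  · exact fun h t ht => (hgain ht fun s hs => h s (hs.trans ht)).2 (h t ht)

end LinearEstimates

end MajorMinor

end

/-- Every affine strategy has a finite cost; a best affine strategy exists; an affine strategy is
best if and only if its common and local controls have the stated form; and any two best affine
strategies generate almost surely the same control actions. -/
theorem mainTheorem4 {n : ℕ} (M : MajorMinor.Model n) {Ω : Type*} [MeasurableSpace Ω]
    (μ : MeasureTheory.Measure Ω) [MeasureTheory.IsProbabilityMeasure μ]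
    (P : MajorMinor.Noise M Ω) (hP : P.Admissible μ) :
    (∀ g : MajorMinor.AffineStrategy M,
      MeasureTheory.Integrable (MajorMinor.pathCost P (g.control P)) μ) ∧
    (∃ g : MajorMinor.AffineStrategy M, g.IsOptimal P μ) ∧
    (∀ g : MajorMinor.AffineStrategy M, g.IsOptimal P μ ↔ g.HasGainForm P μ) ∧
    (∀ g g' : MajorMinor.AffineStrategy M, g.IsOptimal P μ → g'.IsOptimal P μ →
      ∀ t < M.N, ∀ᵐ ω ∂μ, g.control P t ω = g'.control P t ω) := by
  refine ⟨fun g => MajorMinor.integrable_pathCost hP fun t _ => g.isAdaptedAt_control P t, ?_,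
    fun g => (MajorMinor.isOptimal_iff_isFeedback hP g).trans
      (MajorMinor.hasGainForm_iff_isFeedback hP g).symm, fun g g' hg hg' t ht => ?_⟩
  · obtain ⟨g, hg⟩ := MajorMinor.exists_isFeedback hP
    exact ⟨g, (MajorMinor.isOptimal_iff_isFeedback hP g).2 hg⟩
  · exact MajorMinor.ae_control_eq_of_isFeedback hP
      ((MajorMinor.isOptimal_iff_isFeedback hP g).1 hg)
      ((MajorMinor.isOptimal_iff_isFeedback hP g').1 hg') ht
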